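/- A bicolored graph is a finite simple graph whose edges are each colored red or blue; it is $\varepsilon$-balanced if each color class contains at least $\varepsilon\cdot e(G)$ of its $e(G)$ edges. A Type 1 (respectively Type 2) $t$-graph is a bicolored $K_{2t}$ in which one of the two color classes is a clique on $t$ vertices (respectively the union of two vertex-disjoint cliques on $t$ vertices each). A bicolored graph is inevitable if, for all sufficiently large $t$, it embeds (preserving colors) in some Type 1 $t$-graph and in some Type 2 $t$-graph. For a bicolored graph $H$, let $\overline H$ be obtained from $H$ by exchanging the two colors, and let $\mathrm{ex}(\varepsilon,n,H)$ be the maximum number of edges of an $n$-vertex $\varepsilon$-balanced bicolored graph that contains neither a copy of $H$ nor a copy of $\overline H$ (as a not necessarily induced subgraph, with colors preserved). Write $\mathrm{ex}(\varepsilon,H)=\lim_{n\to\infty}\mathrm{ex}(\varepsilon,n,H)/\binom n2$. Theorem 4.1 (cycle theorem). Let $C$ be an inevitable, non-monochromatic bicolored cycle in which every maximal blue path (with at least one edge) has even length (number of edges). 1. If one of the two color classes of $C$ has an isolated edge (an edge sharing no vertex with another edge of the same color), then the limit $\mathrm{ex}(\tfrac12,C)$ exists and equals $\tfrac23$. 2.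 Otherwise, all maximal red paths and all maximal blue paths of $C$ (with at least one edge) have length at least $2$, and the limit $\mathrm{ex}(\tfrac12,C)$ exists and equals $\tfrac12$. -/

import Mathlib

open Filter Topology

/-- A bicolored graph on the vertex set `V`: a simple graph each of whose edges is colored
either red or blue, given by its two (edge-disjoint) color classes. -/
structure BicoloredGraph (V : Type*) where
  red : SimpleGraph V
  blue : SimpleGraph V
  disjoint : Disjoint red blue

namespace BicoloredGraph

variable {V W : Type*}

/-- The underlying uncolored graph. -/
def underlying (G : BicoloredGraph V) : SimpleGraph V := G.red ⊔ G.blue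

/-- The same graph with the two colors exchanged. -/
def swap (G : BicoloredGraph V) : BicoloredGraph V := ⟨G.blue, G.red, G.disjoint.symm⟩

/-- `G` contains a (not necessarily induced) copy of `H`, with matching colors. -/
def Contains (G : BicoloredGraph W) (H : BicoloredGraph V) : Prop :=
  ∃ f : V ↪ W, (∀ u v, H.red.Adj u v → G.red.Adj (f u) (f v)) ∧
    (∀ u v, H.blue.Adj u v → G.blue.Adj (f u) (f v))

/-- Number of edges (used for finite vertex sets). -/
noncomputable def edgeCount (G : BicoloredGraph V) : ℕ := G.underlying.edgeSet.ncard

/-- `G` is `ε`-balanced: each color class has at least `ε * e(G)` edges. -/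
def IsBalanced (G : BicoloredGraph V) (ε : ℝ) : Prop :=
  ε * G.edgeCount ≤ G.red.edgeSet.ncard ∧ ε * G.edgeCount ≤ G.blue.edgeSet.ncard

/-- Both colors occur. -/
def IsNonMonochromatic (G : BicoloredGraph V) : Prop := G.red ≠ ⊥ ∧ G.blue ≠ ⊥

/-- `G` is a cycle (of some length `k ≥ 3`) with colored edges. -/
def IsCycle (G : BicoloredGraph V) : Prop :=
  ∃ k : ℕ, 3 ≤ k ∧ Nonempty (G.underlying ≃g SimpleGraph.cycleGraph k)

/-- The bicolored complete graph on `2t` vertices whose red class is a clique on `t` vertices. -/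
def type1 (t : ℕ) : BicoloredGraph (Fin t ⊕ Fin t) where
  red := (⊤ : SimpleGraph (Fin t)) ⊕g (⊥ : SimpleGraph (Fin t))
  blue := ((⊤ : SimpleGraph (Fin t)) ⊕g (⊥ : SimpleGraph (Fin t)))ᶜ
  disjoint := disjoint_compl_right

/-- The bicolored complete graph on `2t` vertices whose red class consists of two disjoint
cliques on `t` vertices each. -/
def type2 (t : ℕ) : BicoloredGraph (Fin t ⊕ Fin t) where
  red := (⊤ : SimpleGraph (Fin t)) ⊕g (⊤ : SimpleGraph (Fin t))
  blue := ((⊤ : SimpleGraph (Fin t)) ⊕g (⊤ : SimpleGraph (Fin t)))ᶜ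
  disjoint := disjoint_compl_right

/-- `H` is inevitable: for all large `t` it embeds in an unavoidable `t`-graph of Type 1 and in
one of Type 2, where in each type either color may play the role of the clique color. -/
def IsInevitable (H : BicoloredGraph V) : Prop :=
  ∀ᶠ t : ℕ in atTop,
    ((type1 t).Contains H ∨ (type1 t).swap.Contains H) ∧
    ((type2 t).Contains H ∨ (type2 t).swap.Contains H)

/-- A family of bicolored graphs is color-consistent if exchanging the colors preserves it. -/
def IsColorConsistent (F : Set (BicoloredGraph V)) : Prop := swap '' F = F

/-- The color-consistent family determined by a single graph: the graph itself together with its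
color-swapped version. -/
def colorClosure (H : BicoloredGraph V) : Set (BicoloredGraph V) := {H, H.swap}

theorem isColorConsistent_colorClosure (H : BicoloredGraph V) :
    IsColorConsistent (colorClosure H) := by
  have h : H.swap.swap = H := rfl
  simp [IsColorConsistent, colorClosure, Set.image_insert_eq, h, Set.pair_comm]

/-- The possible numbers of edges of `n`-vertex `ε`-balanced bicolored graphs avoiding `F`. -/
def avoidingEdgeCounts (ε : ℝ) (n : ℕ) (F : Set (BicoloredGraph V)) : Set ℕ :=
  {m | ∃ G : BicoloredGraph (Fin n),
    G.IsBalanced ε ∧ (∀ H ∈ F, ¬ G.Contains H) ∧ G.edgeCount = m}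

/-- `ex(ε, n, F)`, the maximum number of edges in an `n`-vertex `ε`-balanced bicolored graph
that avoids all members of `F`. -/
noncomputable def ex (ε : ℝ) (n : ℕ) (F : Set (BicoloredGraph V)) : ℕ :=
  sSup (avoidingEdgeCounts ε n F)

theorem bddAbove_avoidingEdgeCounts (ε : ℝ) (n : ℕ) (F : Set (BicoloredGraph V)) :
    BddAbove (avoidingEdgeCounts ε n F) := by
  refine ⟨(Set.univ : Set (Sym2 (Fin n))).ncard, ?_⟩
  rintro m ⟨G, -, -, rfl⟩
  exact Set.ncard_le_ncard (Set.subset_univ _) Set.finite_univ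

/-- If the members of `F` all have both colors, the maximum defining `ex` is attained. -/
theorem isGreatest_ex (ε : ℝ) (n : ℕ) (F : Set (BicoloredGraph V))
    (hF : ∀ H ∈ F, H.IsNonMonochromatic) :
    IsGreatest (avoidingEdgeCounts ε n F) (ex ε n F) := by
  have hne : (avoidingEdgeCounts ε n F).Nonempty := by
    refine ⟨_, ⟨⊥, ⊥, disjoint_bot_left⟩, ?_, ?_, rfl⟩
    · simp [IsBalanced, edgeCount, underlying]
    · rintro H hH ⟨f, h, -⟩
      exact (hF H hH).1 (by ext u v; simpa using h u v)
  exact ⟨Nat.sSup_mem hne (bddAbove_avoidingEdgeCounts ε n F),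
    fun m hm => le_csSup (bddAbove_avoidingEdgeCounts ε n F) hm⟩

/-- `ex(ε, F) = c`: the limit of `ex(ε, n, F) / (n choose 2)` as `n → ∞` exists and equals `c`. -/
def HasDensity (ε : ℝ) (F : Set (BicoloredGraph V)) (c : ℝ) : Prop :=
  Tendsto (fun n : ℕ => (ex ε n F : ℝ) / (n.choose 2 : ℝ)) atTop (𝓝 c)

/-- A maximal path of a graph: a path with at least one edge which cannot be prolonged to a
longer path at either of its ends. -/
def IsMaximalPath {G : SimpleGraph V} {u v : V} (p : G.Walk u v) : Prop :=
  p.IsPath ∧ 1 ≤ p.length ∧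
    (∀ w, G.Adj w u → w ∈ p.support) ∧ (∀ w, G.Adj v w → w ∈ p.support)

/-- The graph has an isolated edge: an edge meeting no other edge of the graph. -/
def HasIsolatedEdge (G : SimpleGraph V) : Prop :=
  ∃ u v, G.Adj u v ∧ (∀ w, G.Adj u w → w = v) ∧ (∀ w, G.Adj v w → w = u)

end BicoloredGraph

/-! Lower bounds: take a red and a blue clique of equal order, both joined in their color to a
common independent set. A vertex meeting both colors must lie in that set, whereas both ends of an
isolated edge of `C` meet both colors. So if some color class of `C` has an isolated edge, three
equal parts avoid `C` and `C.swap`, with edge density tending to 2/3. With an empty middle part no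
vertex meets both colors, which always gives 1/2.

Upper bounds: sampling, pigeonhole over patterns and a blow-up argument (`exists_forall_contains`)
reduce the problem to finite patterns. It suffices that every bicolored `P` whose two ordered-pair
densities both exceed 1/3 (respectively 1/4) receives a homomorphism from `C` or `C.swap`. In a
balanced graph with `e` edges each color has density at least `e / n ^ 2`, about half the edge
density, hence 2/3 and 1/2.

Since blue segments are even, `C` folds onto any triangle with one red and two blue edges and, if no
red edge is isolated, onto a red triangle with a pendant blue edge. A pattern admitting no such map,
in either coloring, is `TriangleMonochromatic`, respectively `MixedTriangleFree`.

For such patterns, maximize the smaller weighted color density over probability weights on the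
vertices. A multiplier `θ` obtained from Hahn–Banach makes `θ * red degree + (1 - θ) * blue degree`
constant on the support (`exists_critical_weights`). Forbidden triangles force certain neighborhoods
to be disjoint, and the resulting linear inequalities give `IsCritical.le_third` and
`IsCritical.le_fourth`. -/

namespace BicoloredGraph

/-! ### Colored cycles and their homomorphisms into small patterns. -/

section Cycles

variable {V W : Type*}

/-- There is a color-preserving homomorphism from `H` to `P`. -/
def HasHom (H : BicoloredGraph V) (P : BicoloredGraph W) : Prop :=
  ∃ h : V → W, (∀ u v, H.red.Adj u v → P.red.Adj (h u) (h v)) ∧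
    (∀ u v, H.blue.Adj u v → P.blue.Adj (h u) (h v))

theorem HasHom.swap {H : BicoloredGraph V} {P : BicoloredGraph W} (h : H.HasHom P) :
    H.swap.HasHom P.swap := by
  obtain ⟨f, hr, hb⟩ := h
  exact ⟨f, hb, hr⟩

theorem underlying_adj {G : BicoloredGraph V} {u v : V} :
    G.underlying.Adj u v ↔ G.red.Adj u v ∨ G.blue.Adj u v := by
  simp [underlying]

theorem not_red_and_blue (G : BicoloredGraph V) {u v : V} (hr : G.red.Adj u v)
    (hb : G.blue.Adj u v) : False := by
  have h := G.disjoint.le_bot (show (G.red ⊓ G.blue).Adj u v from ⟨hr, hb⟩)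
  simp at h

theorem IsCycle.connected {C : BicoloredGraph V} (hC : C.IsCycle) : C.underlying.Connected := by
  obtain ⟨k, hk, ⟨e⟩⟩ := hC
  obtain ⟨n, rfl⟩ : ∃ n, k = n + 1 := ⟨k - 1, by omega⟩
  exact e.connected_iff.mpr SimpleGraph.cycleGraph_connected

/-- A vertex of a cycle has at most two neighbors. -/
theorem IsCycle.eq_of_adj {C : BicoloredGraph V} (hC : C.IsCycle) {u a b c : V}
    (ha : C.underlying.Adj u a) (hb : C.underlying.Adj u b) (hc : C.underlying.Adj u c)
    (hab : a ≠ b) (hac : a ≠ c) : b = c := by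
  obtain ⟨k, hk, ⟨e⟩⟩ := hC
  obtain ⟨n, rfl⟩ : ∃ n, k = n + 2 := ⟨k - 2, by omega⟩
  rw [← e.map_adj_iff, SimpleGraph.cycleGraph_adj] at ha hb hc
  have key : ∀ x, e u - e x = 1 ∨ e x - e u = 1 → e x = e u - 1 ∨ e x = e u + 1 := by
    rintro x (h | h)
    · left; rw [← h]; abel
    · right; rw [← h]; abel
  have hab' : e a ≠ e b := fun h => hab (e.injective h)
  have hac' : e a ≠ e c := fun h => hac (e.injective h)
  apply e.injective
  rcases key _ ha with h1 | h1 <;> rcases key _ hb with h2 | h2 <;> rcases key _ hc with h3 | h3 <;>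
    simp_all

/-- Every vertex of a cycle has a neighbor besides any given one. -/
theorem IsCycle.exists_adj_ne {C : BicoloredGraph V} (hC : C.IsCycle) (u a : V) :
    ∃ b, C.underlying.Adj u b ∧ b ≠ a := by
  obtain ⟨k, hk, ⟨e⟩⟩ := hC
  obtain ⟨n, rfl⟩ : ∃ n, k = n + 3 := ⟨k - 3, by omega⟩
  have h1 : C.underlying.Adj u (e.symm (e u + 1)) := by
    rw [← e.map_adj_iff, SimpleGraph.cycleGraph_adj]; simp
  have h2 : C.underlying.Adj u (e.symm (e u - 1)) := by
    rw [← e.map_adj_iff, SimpleGraph.cycleGraph_adj]; simp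
  by_cases h : e.symm (e u + 1) = a
  · refine ⟨_, h2, fun h' => ?_⟩
    have h3 : e u - 1 = e u + 1 := e.symm.injective (h'.trans h.symm)
    have h4 : (1 : Fin (n + 3)) + 1 = 0 := by
      have := congrArg (fun x => x - e u + 1) h3
      simp only [sub_sub_cancel_left, neg_add_cancel, add_sub_cancel_left] at this
      exact this.symm
    have h5 := congrArg Fin.val h4
    rw [Fin.val_add, Fin.val_one, Fin.val_zero, Nat.mod_eq_of_lt (by omega)] at h5
    omega
  · exact ⟨_, h1, h⟩

/-- A cycle minus an edge is bipartite. -/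
theorem IsCycle.exists_coloring {C : BicoloredGraph V} (hC : C.IsCycle) {a b : V}
    (hab : C.underlying.Adj a b) :
    ∃ c : V → Bool, ∀ x y, C.underlying.Adj x y → ¬(x = a ∧ y = b) → ¬(x = b ∧ y = a) →
      c x ≠ c y := by
  obtain ⟨k, hk, ⟨e⟩⟩ := hC
  obtain ⟨n, rfl⟩ : ∃ n, k = n + 2 := ⟨k - 2, by omega⟩
  -- Color by the parity of the position counted from `b`: it flips along every edge except the
  -- wrap-around one, which is `ab`.
  have main : ∀ a b : V, e b - e a = 1 → ∀ x y, e y - e x = 1 → ¬(x = a ∧ y = b) →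
      decide (Even (e x - e b).val) ≠ decide (Even (e y - e b).val) := by
    intro a b hab x y hxy hne
    have h1 : e y - e b = (e x - e b) + 1 := by rw [← hxy]; abel
    have h2 : e x - e b ≠ Fin.last _ := by
      intro h
      rw [h, Fin.last_add_one, sub_eq_zero] at h1
      refine hne ⟨e.injective ?_, e.injective h1⟩
      rw [← h1] at hab
      rw [← sub_eq_zero, ← sub_sub_sub_cancel_left (e a) (e x) (e y), hab, hxy, sub_self]
    have h3 := Fin.val_add_one_of_lt (Fin.lt_last_iff_ne_last.mpr h2)
    simp only [h1, h3, Nat.even_add_one, ne_eq, decide_eq_decide]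
    tauto
  have hab' := hab
  rw [← e.map_adj_iff, SimpleGraph.cycleGraph_adj] at hab'
  obtain ⟨a', b', hab1, h⟩ : ∃ a' b', e b' - e a' = 1 ∧
      ∀ x y, ¬(x = a ∧ y = b) → ¬(x = b ∧ y = a) → ¬(x = a' ∧ y = b') ∧ ¬(x = b' ∧ y = a') := by
    rcases hab' with h | h
    · exact ⟨b, a, h, fun x y h1 h2 => ⟨h2, h1⟩⟩
    · exact ⟨a, b, h, fun x y h1 h2 => ⟨h1, h2⟩⟩
  refine ⟨fun x => decide (Even (e x - e b').val), fun x y hxy h1 h2 => ?_⟩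
  obtain ⟨h3, h4⟩ := h x y h1 h2
  rw [← e.map_adj_iff, SimpleGraph.cycleGraph_adj] at hxy
  rcases hxy with hxy | hxy
  · exact (main a' b' hab1 y x hxy fun h => h4 ⟨h.2, h.1⟩).symm
  · exact main a' b' hab1 x y hxy h3

theorem IsCycle.exists_red_coloring {C : BicoloredGraph V} (hC : C.IsCycle)
    (hb : C.blue ≠ ⊥) : ∃ c : V → Bool, ∀ x y, C.red.Adj x y → c x ≠ c y := by
  obtain ⟨a, b, hab⟩ := SimpleGraph.ne_bot_iff_exists_adj.mp hb
  obtain ⟨c, hc⟩ := hC.exists_coloring (underlying_adj.mpr (Or.inr hab))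
  refine ⟨c, fun x y hxy => hc x y (underlying_adj.mpr (Or.inl hxy)) ?_ ?_⟩
  · rintro ⟨rfl, rfl⟩; exact C.not_red_and_blue hxy hab
  · rintro ⟨rfl, rfl⟩; exact C.not_red_and_blue hxy hab.symm

theorem IsCycle.swap {C : BicoloredGraph V} (hC : C.IsCycle) : C.swap.IsCycle := by
  have h : C.swap.underlying = C.underlying := sup_comm _ _
  unfold IsCycle
  rwa [h]

/-- From each vertex of a connected graph with a red edge, a blue walk leads to a red edge. -/
theorem exists_blue_reachable {C : BicoloredGraph V} (hC : C.underlying.Connected)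
    (hr : C.red ≠ ⊥) (v : V) : ∃ u, C.blue.Reachable v u ∧ ∃ x, C.red.Adj u x := by
  obtain ⟨a, b, hab⟩ := SimpleGraph.ne_bot_iff_exists_adj.mp hr
  obtain ⟨p⟩ := hC.preconnected v a
  induction p with
  | nil => exact ⟨_, .refl _, b, hab⟩
  | @cons v v' w h p ih =>
    rcases underlying_adj.mp h with h | h
    · exact ⟨v, .refl _, v', h⟩
    · obtain ⟨u, hu, hx⟩ := ih hab
      exact ⟨u, h.reachable.trans hu, hx⟩

/-- A connected bicolored graph with both colors has a vertex meeting both colors. -/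
theorem exists_bichromatic_vertex {C : BicoloredGraph V} (hC : C.underlying.Connected)
    (hr : C.red ≠ ⊥) (hb : C.blue ≠ ⊥) : ∃ u x y, C.red.Adj u x ∧ C.blue.Adj u y := by
  obtain ⟨a, b, hab⟩ := SimpleGraph.ne_bot_iff_exists_adj.mp hb
  obtain ⟨u, ⟨p⟩, x, hx⟩ := exists_blue_reachable hC hr a
  obtain ⟨q⟩ : C.blue.Reachable u a := ⟨p.reverse⟩
  cases q with
  | nil => exact ⟨_, x, b, hx, hab⟩
  | cons h q => exact ⟨_, x, _, hx, h⟩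

/-- If all blue segments of a cycle are even, then some set of vertices off the red edges contains
exactly one end of each blue edge. -/
theorem IsCycle.exists_blue_coloring {C : BicoloredGraph V} (hC : C.IsCycle)
    (hn : C.IsNonMonochromatic)
    (heven : ∀ (u v : V) (p : C.blue.Walk u v), IsMaximalPath p → Even p.length) :
    ∃ o : V → Prop, (∀ u v, C.blue.Adj u v → (o u ↔ ¬ o v)) ∧ ∀ u v, C.red.Adj u v → ¬ o u := by
  classical
  obtain ⟨c, hc⟩ := hC.swap.exists_red_coloring (C := C.swap) hn.1
  change ∀ x y, C.blue.Adj x y → c x ≠ c y at hc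
  have hblue : ∀ u x a b, C.red.Adj u x → C.blue.Adj u a → C.blue.Adj u b → a = b := by
    intro u x a b hx ha hb
    refine hC.eq_of_adj (underlying_adj.mpr (.inl hx)) (underlying_adj.mpr (.inr ha))
      (underlying_adj.mpr (.inr hb)) ?_ ?_
    · rintro rfl; exact C.not_red_and_blue hx ha
    · rintro rfl; exact C.not_red_and_blue hx hb
  let col : C.blue.Coloring Bool := SimpleGraph.Coloring.mk c fun {x y} h => hc x y h
  have hsame : ∀ u v x y, C.red.Adj u x → C.red.Adj v y → C.blue.Reachable u v → c u = c v := by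
    intro u v x y hx hy huv
    obtain ⟨p, hp⟩ := huv.exists_isPath
    by_cases hl : p.length = 0
    · rw [SimpleGraph.Walk.eq_of_length_eq_zero hl]
    -- An end meeting a red edge has at most one blue neighbor, and the path already uses it.
    have hmax : IsMaximalPath p := by
      refine ⟨hp, Nat.one_le_iff_ne_zero.mpr hl, ?_, ?_⟩
      · intro w hw
        have hnil : ¬ p.Nil := fun h => hl (SimpleGraph.Walk.length_eq_zero_iff.mpr h)
        rw [hblue u x w p.snd hx hw.symm (p.adj_snd hnil)]
        exact p.getVert_mem_support 1
      · intro w hw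
        have hnil : ¬ p.Nil := fun h => hl (SimpleGraph.Walk.length_eq_zero_iff.mpr h)
        rw [hblue v y w p.penultimate hy hw (p.adj_penultimate hnil).symm]
        exact p.getVert_mem_support _
    have := (col.even_length_iff_congr p).mp (heven u v p hmax)
    exact Bool.eq_iff_iff.mpr this
  -- These are the vertices at odd blue distance from an end of their blue segment; by `hsame` it
  -- does not matter which end.
  refine ⟨fun v => ∃ u x, C.red.Adj u x ∧ C.blue.Reachable v u ∧ c u ≠ c v, ?_, ?_⟩
  · intro u v huv
    obtain ⟨a, ha, x, hx⟩ := exists_blue_reachable hC.connected hn.1 u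
    have hiff : ∀ w, C.blue.Reachable w a →
        ((∃ u x, C.red.Adj u x ∧ C.blue.Reachable w u ∧ c u ≠ c w) ↔ c a ≠ c w) := by
      intro w hw
      refine ⟨?_, fun h => ⟨a, x, hx, hw, h⟩⟩
      rintro ⟨a', x', hx', hw', h⟩
      rwa [hsame a a' x x' hx hx' (hw.symm.trans hw')]
    refine (hiff u ha).trans (Iff.trans ?_ (hiff v (huv.symm.reachable.trans ha)).not.symm)
    have := hc u v huv
    revert this
    cases c a <;> cases c u <;> cases c v <;> simp
  · rintro u v huv ⟨a, x, hx, hr, hne⟩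
    exact hne (hsame a u x v hx huv hr.symm)

/-- A cycle with even blue segments maps into any triangle with one red and two blue edges. -/
theorem IsCycle.hasHom_of_triangle {C : BicoloredGraph V} (hC : C.IsCycle)
    (hn : C.IsNonMonochromatic)
    (heven : ∀ (u v : V) (p : C.blue.Walk u v), IsMaximalPath p → Even p.length)
    {P : BicoloredGraph W} {s x y : W} (hx : P.blue.Adj s x) (hy : P.blue.Adj s y)
    (hxy : P.red.Adj x y) : C.HasHom P := by
  classical
  obtain ⟨o, ho, ho'⟩ := hC.exists_blue_coloring hn heven
  obtain ⟨c, hc⟩ := hC.exists_red_coloring hn.2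
  -- Blue segments alternate between `s` and `{x, y}` and have their ends off `s`; red edges
  -- alternate between `x` and `y`.
  refine ⟨fun v => if o v then s else if c v then x else y, ?_, ?_⟩
  · intro u v huv
    have h1 := ho' u v huv
    have h2 := ho' v u huv.symm
    have h3 := hc u v huv
    cases hu : c u <;> cases hv : c v <;> simp_all [hxy.symm]
  · intro u v huv
    have h1 := ho u v huv
    by_cases h2 : o v
    · cases hu : c u <;> simp_all [hx.symm, hy.symm]
    · cases hv : c v <;> simp_all

/-- A cycle with even blue segments and no red segment of length one maps into any graph having
a red triangle with a blue edge at one of its vertices. -/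
theorem IsCycle.hasHom_of_pendant {C : BicoloredGraph V} (hC : C.IsCycle)
    (hn : C.IsNonMonochromatic)
    (heven : ∀ (u v : V) (p : C.blue.Walk u v), IsMaximalPath p → Even p.length)
    (hiso : ¬ HasIsolatedEdge C.red)
    {P : BicoloredGraph W} {s x y z : W} (hx : P.red.Adj s x) (hy : P.red.Adj s y)
    (hxy : P.red.Adj x y) (hz : P.blue.Adj s z) : C.HasHom P := by
  classical
  obtain ⟨o, ho, ho'⟩ := hC.exists_blue_coloring hn heven
  obtain ⟨c, hc⟩ := hC.exists_red_coloring hn.2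
  -- Blue segments alternate between `z` and `s`, and inner vertices of red segments between `x` and
  -- `y`. A red edge with both ends sent to `s` would be isolated.
  refine ⟨fun v => if o v then z else if (∃ w, C.blue.Adj v w) then s else
    if c v then x else y, ?_, ?_⟩
  · intro u v huv
    have h1 := ho' u v huv
    have h2 := ho' v u huv.symm
    have h3 := hc u v huv
    have hred : ∀ u v w w', C.red.Adj u v → C.blue.Adj u w → C.red.Adj u w' → w' = v := by
      intro u v w w' h1 h2 h3
      refine (hC.eq_of_adj (underlying_adj.mpr (.inr h2)) (underlying_adj.mpr (.inl h1))
        (underlying_adj.mpr (.inl h3)) ?_ ?_).symm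
      · rintro rfl; exact C.not_red_and_blue h1 h2
      · rintro rfl; exact C.not_red_and_blue h3 h2
    by_cases hu : ∃ w, C.blue.Adj u w
    · have hv : ¬ ∃ w, C.blue.Adj v w := by
        rintro ⟨w', hw'⟩
        obtain ⟨w, hw⟩ := hu
        exact hiso ⟨u, v, huv, fun a ha => hred u v w a huv hw ha,
          fun a ha => hred v u w' a huv.symm hw' ha⟩
      simp only [h1, h2, hu, hv, if_true, if_false]
      split_ifs <;> assumption
    · by_cases hv : ∃ w, C.blue.Adj v w
      · simp only [h1, h2, hu, hv, if_true, if_false]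
        split_ifs
        exacts [hx.symm, hy.symm]
      · simp only [h1, h2, hu, hv, if_false]
        revert h3
        cases c u <;> cases c v <;> simp [hxy, hxy.symm]
  · intro u v huv
    have h1 := ho u v huv
    have hu : ∃ w, C.blue.Adj u w := ⟨v, huv⟩
    have hv : ∃ w, C.blue.Adj v w := ⟨u, huv.symm⟩
    by_cases h2 : o v <;> simp_all [hz.symm]

/-- A maximal path of length one is an isolated edge. -/
theorem two_le_length_of_isMaximalPath {G : SimpleGraph V} (hG : ¬ HasIsolatedEdge G)
    {u v : V} (p : G.Walk u v) (hp : IsMaximalPath p) : 2 ≤ p.length := by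
  obtain ⟨-, h1, hu, hv⟩ := hp
  by_contra h
  have hl : p.length = 1 := by omega
  cases p with
  | nil => simp at h1
  | cons hadj q =>
    cases q with
    | cons _ q => simp at hl
    | nil =>
      refine hG ⟨_, _, hadj, fun w hw => ?_, fun w hw => ?_⟩
      · have := hu w hw.symm
        simp only [SimpleGraph.Walk.support_cons, SimpleGraph.Walk.support_nil, List.mem_cons,
          List.not_mem_nil, or_false] at this
        exact this.resolve_left hw.ne'
      · have := hv w hw
        simp only [SimpleGraph.Walk.support_cons, SimpleGraph.Walk.support_nil, List.mem_cons,
          List.not_mem_nil, or_false] at this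
        exact this.resolve_right hw.ne'

/-- The ends of an isolated red edge of a cycle meet blue edges. -/
theorem IsCycle.exists_blue_of_isolated {C : BicoloredGraph V} (hC : C.IsCycle) {u v : V}
    (h : ∀ w, C.red.Adj u w → w = v) : ∃ w, C.blue.Adj u w := by
  obtain ⟨w, hw, hne⟩ := hC.exists_adj_ne u v
  exact ⟨w, (underlying_adj.mp hw).resolve_left fun h' => hne (h w h')⟩

end Cycles

end BicoloredGraph

namespace BicoloredGraph

/-! ### Weighted color densities and their critical points. -/

section Weights

open Classical in
/-- The real-valued indicator of a proposition. -/
noncomputable def ind (p : Prop) : ℝ := if p then 1 else 0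

theorem ind_nonneg (p : Prop) : 0 ≤ ind p := by unfold ind; split_ifs <;> norm_num

theorem ind_le_one (p : Prop) : ind p ≤ 1 := by unfold ind; split_ifs <;> norm_num

theorem ind_of {p : Prop} (h : p) : ind p = 1 := by simp [ind, h]

theorem ind_of_not {p : Prop} (h : ¬p) : ind p = 0 := by simp [ind, h]

theorem ind_add_le_one {p q : Prop} (h : p → ¬q) : ind p + ind q ≤ 1 := by
  by_cases hp : p
  · simp [ind, hp, h hp]
  · simpa [ind, hp] using ind_le_one q

theorem ind_or {p q : Prop} (h : p → ¬q) : ind (p ∨ q) = ind p + ind q := by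
  by_cases hp : p
  · rw [ind_of hp, ind_of_not (h hp), ind_of (Or.inl hp), add_zero]
  · rw [ind_of_not hp, zero_add]; simp only [hp, false_or]

theorem ind_add_le_one₃ {p q r : Prop} (hpq : p → ¬q) (hr : p ∨ q → ¬r) :
    ind p + ind q + ind r ≤ 1 := by
  rw [← ind_or hpq]; exact ind_add_le_one hr

theorem ind_add_le_one₄ {p q r s : Prop} (hpq : p → ¬q) (hr : p ∨ q → ¬r)
    (hs : (p ∨ q) ∨ r → ¬s) : ind p + ind q + ind r + ind s ≤ 1 := by
  rw [← ind_or hpq, ← ind_or hr]; exact ind_add_le_one hs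

variable {K : Type*}

/-- No vertex sees both colors in a triangle. -/
def TriangleMonochromatic (P : BicoloredGraph K) : Prop :=
  ∀ a b c, P.red.Adj a b → P.blue.Adj a c → ¬ P.underlying.Adj b c

theorem TriangleMonochromatic.swap {P : BicoloredGraph K} (h : P.TriangleMonochromatic) :
    P.swap.TriangleMonochromatic := by
  intro a b c hb hc hbc
  refine h a c b hc hb ?_
  have e : P.swap.underlying = P.underlying := sup_comm _ _
  rw [← e]; exact hbc.symm

/-- No vertex meeting both colors lies in a triangle. -/
def MixedTriangleFree (P : BicoloredGraph K) : Prop :=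
  ∀ s p q, P.red.Adj s p → P.blue.Adj s q → ∀ x y, P.underlying.Adj s x →
    P.underlying.Adj s y → ¬ P.underlying.Adj x y

theorem MixedTriangleFree.swap {P : BicoloredGraph K} (h : P.MixedTriangleFree) :
    P.swap.MixedTriangleFree := by
  intro s p q hp hq
  have e : P.swap.underlying = P.underlying := sup_comm _ _
  rw [e]
  exact h s q p hq hp

variable [Fintype K]

/-- The weight of the neighborhood of a vertex. -/
noncomputable def wdeg (G : SimpleGraph K) (w : K → ℝ) (v : K) : ℝ :=
  ∑ u, w u * ind (G.Adj v u)

/-- The total weight of ordered adjacent pairs. -/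
noncomputable def wedges (G : SimpleGraph K) (w : K → ℝ) : ℝ :=
  ∑ v, w v * wdeg G w v

/-- Optimality conditions for a weighting of the vertices of a bicolored graph maximizing the
smaller of the two weighted color classes. -/
structure IsCritical (P : BicoloredGraph K) (w : K → ℝ) (θ c : ℝ) : Prop where
  nonneg : ∀ v, 0 ≤ w v
  sum_eq : ∑ v, w v = 1
  deg_eq : ∀ v, 0 < w v → θ * wdeg P.red w v + (1 - θ) * wdeg P.blue w v = c
  le_red : c ≤ wedges P.red w
  le_blue : c ≤ wedges P.blue w
  pos : 0 < c
  half_le : 1 / 2 ≤ θ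
  le_one : θ ≤ 1

theorem wdeg_nonneg {G : SimpleGraph K} {w : K → ℝ} (hw : ∀ v, 0 ≤ w v) (v : K) :
    0 ≤ wdeg G w v :=
  Finset.sum_nonneg fun u _ => mul_nonneg (hw u) (ind_nonneg _)

theorem exists_adj_of_wdeg_pos {G : SimpleGraph K} {w : K → ℝ} (hw : ∀ v, 0 ≤ w v) {v : K}
    (h : 0 < wdeg G w v) : ∃ u, G.Adj v u ∧ 0 < w u := by
  obtain ⟨u, -, hu⟩ := Finset.exists_ne_zero_of_sum_ne_zero h.ne'
  refine ⟨u, ?_, lt_of_le_of_ne (hw u) ?_⟩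
  · by_contra hn
    exact hu (by rw [ind_of_not hn, mul_zero])
  · intro h0
    exact hu (by rw [← h0, zero_mul])

theorem wdeg_pos {G : SimpleGraph K} {w : K → ℝ} (hw : ∀ v, 0 ≤ w v) {v u : K}
    (h : G.Adj v u) (hu : 0 < w u) : 0 < wdeg G w v := by
  refine Finset.sum_pos' (fun u _ => mul_nonneg (hw u) (ind_nonneg _)) ⟨u, Finset.mem_univ _, ?_⟩
  rw [ind_of h, mul_one]; exact hu

theorem exists_edge_of_wedges_pos {G : SimpleGraph K} {w : K → ℝ} (hw : ∀ v, 0 ≤ w v)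
    (h : 0 < wedges G w) : ∃ u v, G.Adj u v ∧ 0 < w u ∧ 0 < w v := by
  obtain ⟨u, -, hu⟩ := Finset.exists_ne_zero_of_sum_ne_zero h.ne'
  have h1 : 0 < w u := lt_of_le_of_ne (hw u) fun h0 => hu (by rw [← h0, zero_mul])
  have h2 : 0 < wdeg G w u :=
    lt_of_le_of_ne (wdeg_nonneg hw u) fun h0 => hu (by rw [← h0, mul_zero])
  obtain ⟨v, hv, hv'⟩ := exists_adj_of_wdeg_pos hw h2
  exact ⟨u, v, hv, h1, hv'⟩

theorem sum_mul_le_one {w f : K → ℝ} (hw : ∀ v, 0 ≤ w v) (h1 : ∑ v, w v = 1)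
    (hf : ∀ v, f v ≤ 1) : ∑ v, w v * f v ≤ 1 := by
  rw [← h1]
  exact Finset.sum_le_sum fun v _ => mul_le_of_le_one_right (hw v) (hf v)

namespace IsCritical

variable {P : BicoloredGraph K} {w : K → ℝ} {θ c : ℝ}

/-- Red carries the larger coefficient: `1 - θ ≤ θ`. -/
theorem le_mul_deg (h : P.IsCritical w θ c) {v : K} (hv : 0 < w v) :
    c ≤ θ * (wdeg P.red w v + wdeg P.blue w v) := by
  have h1 := h.deg_eq v hv
  have h2 := wdeg_nonneg (G := P.blue) h.nonneg v
  nlinarith [h.half_le]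

/-- Disjointness of three neighborhoods. -/
theorem three_le_one (h : P.IsCritical w θ c) {G₁ G₂ G₃ : SimpleGraph K} {a₁ a₂ a₃ : K}
    (h12 : ∀ x, G₁.Adj a₁ x → ¬ G₂.Adj a₂ x)
    (h3 : ∀ x, G₁.Adj a₁ x ∨ G₂.Adj a₂ x → ¬ G₃.Adj a₃ x) :
    wdeg G₁ w a₁ + wdeg G₂ w a₂ + wdeg G₃ w a₃ ≤ 1 := by
  have := sum_mul_le_one (f := fun x => ind (G₁.Adj a₁ x) + ind (G₂.Adj a₂ x) + ind (G₃.Adj a₃ x))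
    h.nonneg h.sum_eq fun x => ind_add_le_one₃ (h12 x) (h3 x)
  simpa [wdeg, mul_add, Finset.sum_add_distrib] using this

/-- Disjointness of four neighborhoods. -/
theorem four_le_one (h : P.IsCritical w θ c) {G₁ G₂ G₃ G₄ : SimpleGraph K} {a₁ a₂ a₃ a₄ : K}
    (h12 : ∀ x, G₁.Adj a₁ x → ¬ G₂.Adj a₂ x)
    (h3 : ∀ x, G₁.Adj a₁ x ∨ G₂.Adj a₂ x → ¬ G₃.Adj a₃ x)
    (h4 : ∀ x, (G₁.Adj a₁ x ∨ G₂.Adj a₂ x) ∨ G₃.Adj a₃ x → ¬ G₄.Adj a₄ x) :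
    wdeg G₁ w a₁ + wdeg G₂ w a₂ + wdeg G₃ w a₃ + wdeg G₄ w a₄ ≤ 1 := by
  have := sum_mul_le_one (f := fun x => ind (G₁.Adj a₁ x) + ind (G₂.Adj a₂ x) +
    ind (G₃.Adj a₃ x) + ind (G₄.Adj a₄ x))
    h.nonneg h.sum_eq fun x => ind_add_le_one₄ (h12 x) (h3 x) (h4 x)
  simpa [wdeg, mul_add, Finset.sum_add_distrib] using this

/-- If vertices meeting red edges have no neighbors that meet only blue edges, then all vertices of
positive weight meet red edges. -/
theorem wdeg_red_pos (h : P.IsCritical w θ c) (hc : 1 / 4 < c)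
    (hA : ∀ s v, 0 < w s → 0 < w v → P.blue.Adj s v → 0 < wdeg P.red w s →
      0 < wdeg P.red w v) {v : K} (hv : 0 < w v) : 0 < wdeg P.red w v := by
  by_contra hn
  have hv0 : wdeg P.red w v = 0 := le_antisymm (not_lt.mp hn) (wdeg_nonneg h.nonneg v)
  obtain ⟨u, u', huu, hu, hu'⟩ := exists_edge_of_wedges_pos h.nonneg (h.pos.trans_le h.le_red)
  have hur : 0 < wdeg P.red w u := wdeg_pos h.nonneg huu hu'
  set y := ∑ x, w x * ind (wdeg P.red w x = 0) with hy
  have h1 : wdeg P.blue w v ≤ y := by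
    refine Finset.sum_le_sum fun x _ => ?_
    rcases (h.nonneg x).eq_or_lt with hx | hx
    · rw [← hx]; simp
    · by_cases hvx : P.blue.Adj v x
      · have : wdeg P.red w x = 0 := by
          by_contra h0
          have := hA x v hx hv hvx.symm (lt_of_le_of_ne (wdeg_nonneg h.nonneg x) (Ne.symm h0))
          exact hn this
        rw [ind_of hvx, ind_of this]
      · rw [ind_of_not hvx, mul_zero]
        exact mul_nonneg hx.le (ind_nonneg _)
  have h2 : wdeg P.red w u + wdeg P.blue w u + y ≤ 1 := by
    rw [← h.sum_eq, hy, wdeg, wdeg, ← Finset.sum_add_distrib, ← Finset.sum_add_distrib]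
    refine Finset.sum_le_sum fun x _ => ?_
    rcases (h.nonneg x).eq_or_lt with hx | hx
    · rw [← hx]; simp
    · rw [← mul_add, ← mul_add]
      refine mul_le_of_le_one_right hx.le (ind_add_le_one₃ ?_ ?_)
      · exact fun h1 h2 => P.not_red_and_blue h1 h2
      · rintro (hux | hux)
        · exact (wdeg_pos h.nonneg hux.symm hu).ne'
        · exact (hA u x hu hx hux hur).ne'
  have h3 := h.le_mul_deg hu
  have h4 := h.deg_eq v hv
  rw [hv0] at h4
  have hθ := h.half_le
  have hθ' := h.le_one
  -- Averaging `h5` and `h6` with coefficients `1 - θ` and `θ` eliminates `y` and gives `c ≤ θ * (1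
  -- - θ) ≤ 1 / 4`.
  have h5 : c ≤ θ * (1 - y) := h3.trans (mul_le_mul_of_nonneg_left (by linarith) (by linarith))
  have h6 : c ≤ (1 - θ) * y := by nlinarith
  nlinarith [sq_nonneg (2 * θ - 1), mul_le_mul_of_nonneg_left h5 (sub_nonneg.mpr hθ'),
    mul_le_mul_of_nonneg_left h6 (by linarith : 0 ≤ θ)]

/-- A triangle never mixes colors, so neighborhoods in different colors across an edge are disjoint.
After showing that every vertex of the support meets red, the argument splits at `θ = 2 / 3`: for
large `θ` look at a vertex of maximal blue degree, for small `θ` at a blue edge, in or out of a blue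
triangle. -/
theorem le_third (h : P.IsCritical w θ c) (hT : P.TriangleMonochromatic) : c ≤ 1 / 3 := by
  by_contra! hc
  have hθ := h.half_le
  have hθ' := h.le_one
  have hT' : ∀ a b d, P.red.Adj a b → P.blue.Adj a d → P.red.Adj b d ∨ P.blue.Adj b d → False :=
    fun a b d h1 h2 h3 => hT a b d h1 h2 (underlying_adj.mpr h3)
  have hRB : ∀ a b, P.red.Adj a b → ¬ P.blue.Adj a b := fun a b h1 h2 => P.not_red_and_blue h1 h2
  -- No neighbor of `u` is a blue neighbor of `s`, as `s`, `u` and it would form a triangle with two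
  -- colors at `s`.
  have hu : ∀ s u v, P.red.Adj s u → P.blue.Adj s v → 0 < w u →
      c ≤ θ * (1 - wdeg P.blue w s) := by
    intro s u v hsu hsv hw
    have h1 : wdeg P.red w u + wdeg P.blue w u + wdeg P.blue w s ≤ 1 :=
      h.three_le_one (fun x => hRB u x) fun x hx hx' => hT' s u x hsu hx' hx
    exact (h.le_mul_deg hw).trans (mul_le_mul_of_nonneg_left (by linarith) (by linarith))
  have hred : ∀ v, 0 < w v → 0 < wdeg P.red w v := by
    refine fun v hv => h.wdeg_red_pos (by linarith) ?_ hv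
    intro s v hs hv hsv hrs
    by_contra hn
    have hv0 : wdeg P.red w v = 0 := le_antisymm (not_lt.mp hn) (wdeg_nonneg h.nonneg v)
    obtain ⟨u, hsu, hwu⟩ := exists_adj_of_wdeg_pos h.nonneg hrs
    have h1 := hu s u v hsu hsv hwu
    have h2 : wdeg P.red w v + wdeg P.blue w v + wdeg P.red w s ≤ 1 :=
      h.three_le_one (fun x => hRB v x) fun x hx hx' =>
        hT' s x v hx' hsv (hx.imp (fun h => h.symm) (fun h => h.symm))
    have h3 := h.deg_eq v hv
    have h4 := h.deg_eq s hs
    rw [hv0] at h2 h3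
    have h5 : c ≤ (1 - θ) * (1 - wdeg P.red w s) := by
      have := mul_le_mul_of_nonneg_left (show wdeg P.blue w v ≤ 1 - wdeg P.red w s by linarith)
        (sub_nonneg.mpr hθ')
      linarith
    -- Coefficients `(1 - θ) ^ 2` and `θ ^ 2` are chosen so that the degrees of `s` combine into
    -- `deg_eq`. As `θ * (1 - θ) ≤ 1 / 4`, this forces `c ≤ 1 / 3`.
    have h6 : c * (1 - θ * (1 - θ)) ≤ θ * (1 - θ) := by
      have e1 := mul_le_mul_of_nonneg_left h1 (sq_nonneg (1 - θ))
      have e2 := mul_le_mul_of_nonneg_left h5 (sq_nonneg θ)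
      have e3 : θ * (1 - θ) * (θ * wdeg P.red w s + (1 - θ) * wdeg P.blue w s)
        = θ * (1 - θ) * c := by rw [h4]
      linarith
    nlinarith [sq_nonneg (2 * θ - 1)]
  have hmix : ∀ s v, P.blue.Adj s v → 0 < w s → c ≤ θ * (1 - wdeg P.blue w s) := by
    intro s v hsv hs
    obtain ⟨u, hsu, hwu⟩ := exists_adj_of_wdeg_pos h.nonneg (hred s hs)
    exact hu s u v hsu hsv hwu
  have hRR : ∀ s v x, P.blue.Adj s v → P.red.Adj s x → ¬ P.red.Adj v x := fun s v x h1 h2 h3 =>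
    hT' s x v h2 h1 (.inl h3.symm)
  have hRB' : ∀ s v x, P.blue.Adj s v → P.red.Adj s x → ¬ P.blue.Adj v x := fun s v x h1 h2 h3 =>
    hT' s x v h2 h1 (.inr h3.symm)
  rcases le_or_gt (2 / 3) θ with hθ2 | hθ2
  · obtain ⟨u, u', -, hwu, -⟩ := exists_edge_of_wedges_pos h.nonneg (h.pos.trans_le h.le_blue)
    obtain ⟨s, hs, hmax⟩ := Finset.exists_max_image (Finset.univ.filter fun v => 0 < w v)
      (wdeg P.blue w) ⟨u, by simpa using hwu⟩
    simp only [Finset.mem_filter, Finset.mem_univ, true_and] at hs hmax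
    have hβ : c ≤ wdeg P.blue w s := by
      refine h.le_blue.trans ?_
      calc wedges P.blue w ≤ ∑ v, w v * wdeg P.blue w s := by
            refine Finset.sum_le_sum fun v _ => ?_
            rcases (h.nonneg v).eq_or_lt with hv | hv
            · rw [← hv]; simp
            · exact mul_le_mul_of_nonneg_left (hmax v hv) hv.le
        _ = wdeg P.blue w s := by rw [← Finset.sum_mul, h.sum_eq, one_mul]
    obtain ⟨v, hsv, hv⟩ := exists_adj_of_wdeg_pos h.nonneg (h.pos.trans_le hβ)
    have h1 : wdeg P.red w s + wdeg P.red w v + wdeg P.blue w s ≤ 1 := by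
      refine h.three_le_one (fun x => hRR s v x hsv) ?_
      rintro x (hx | hx)
      · exact hRB s x hx
      · exact hRB' v s x hsv.symm hx
    have h2 := h.deg_eq s hs
    have h3 := h.deg_eq v hv
    have h4 := mul_le_mul_of_nonneg_left (hmax v hv) (sub_nonneg.mpr hθ')
    -- The mixed degrees of `s` and `v` agree and `v` has the smaller blue degree. The final
    -- estimate then needs `3 * θ - 2 ≥ 0` to replace the blue degree of `s` by its lower bound `c`.
    have h5 : wdeg P.red w s ≤ wdeg P.red w v := by nlinarith
    have h6 : 2 * wdeg P.red w s ≤ 1 - wdeg P.blue w s := by linarith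
    have h7 := mul_le_mul_of_nonneg_left h6 (by linarith : 0 ≤ θ)
    have h8 := mul_le_mul_of_nonneg_left hβ (by linarith : 0 ≤ 3 * θ - 2)
    nlinarith
  · obtain ⟨s, v, hsv, hs, hv⟩ := exists_edge_of_wedges_pos h.nonneg (h.pos.trans_le h.le_blue)
    by_cases ht : ∃ t, P.blue.Adj s t ∧ P.blue.Adj v t ∧ 0 < w t
    · obtain ⟨t, hst, hvt, ht⟩ := ht
      -- In a blue triangle the three red neighborhoods are disjoint from each other and from every
      -- blue neighborhood of a corner.
      have key : ∀ a b d, P.blue.Adj a b → P.blue.Adj a d → P.blue.Adj b d →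
          wdeg P.red w a + wdeg P.red w b + wdeg P.red w d + wdeg P.blue w a ≤ 1 := by
        intro a b d hab had hbd
        refine h.four_le_one (fun x => hRR a b x hab) ?_ ?_
        · rintro x (hx | hx)
          · exact hRR a d x had hx
          · exact hRR b d x hbd hx
        · rintro x ((hx | hx) | hx)
          · exact hRB a x hx
          · exact hRB' b a x hab.symm hx
          · exact hRB' d a x had.symm hx
      have k1 := key s v t hsv hst hvt
      have k2 := key v s t hsv.symm hvt hst
      have k3 := key t s v hst.symm hvt.symm hsv
      have m1 := hmix s v hsv hs
      have m2 := hmix v s hsv.symm hv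
      have m3 := hmix t s hst.symm ht
      have e1 := h.deg_eq s hs
      have e2 := h.deg_eq v hv
      have e3 := h.deg_eq t ht
      set ρ := wdeg P.red w s + wdeg P.red w v + wdeg P.red w t with hρ
      set σ := wdeg P.blue w s + wdeg P.blue w v + wdeg P.blue w t with hσ
      have a1 : 3 * ρ ≤ 3 - σ := by linarith
      have a2 : 3 * c ≤ θ * (3 - σ) := by nlinarith
      have a3 : 3 * c = θ * ρ + (1 - θ) * σ := by nlinarith
      have a4 := mul_le_mul_of_nonneg_left a1 (by linarith : 0 ≤ θ)
      have a5 := mul_le_mul_of_nonneg_left a2 (by linarith : 0 ≤ 3 - 4 * θ)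
      -- Elimination of `ρ` and `σ`. With `c > 1 / 3` it would give `9 * θ ^ 2 - 10 * θ + 3 < 0`,
      -- impossible by completing the square.
      have a6 : c * (3 - θ) ≤ 3 * θ * (1 - θ) := by nlinarith
      nlinarith [sq_nonneg (9 * θ - 5)]
    -- Without a blue triangle on `sv` in the support, the full neighborhoods are disjoint there, so
    -- `2 * c ≤ θ < 2 / 3`.
    · have h1 : wdeg P.red w s + wdeg P.blue w s + (wdeg P.red w v + wdeg P.blue w v) ≤ 1 := by
        rw [← h.sum_eq]
        simp only [wdeg, ← Finset.sum_add_distrib]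
        refine Finset.sum_le_sum fun x _ => ?_
        rcases (h.nonneg x).eq_or_lt with hx | hx
        · rw [← hx]; simp
        · rw [← mul_add, ← mul_add, ← mul_add, ← add_assoc]
          refine mul_le_of_le_one_right hx.le (ind_add_le_one₄ (hRB s x) ?_ ?_)
          · rintro (h1 | h1) h2
            · exact hRR s v x hsv h1 h2
            · exact hRB' v s x hsv.symm h2 h1
          · rintro ((h1 | h1) | h1) h2
            · exact hRB' s v x hsv h1 h2
            · exact ht ⟨x, h1, h2, hx⟩
            · exact hRB v x h1 h2
      have h2 := h.le_mul_deg hs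
      have h3 := h.le_mul_deg hv
      have h4 := mul_le_mul_of_nonneg_left h1 (by linarith : 0 ≤ θ)
      linarith

/-- A blue edge at a vertex meeting both colors lies in no triangle, so its ends have total degree
at most 1. Once the whole support meets red, this holds for all blue edges there; summing over them
and applying Cauchy–Schwarz to the blue degrees yields the bound, as in Mantel's theorem. -/
theorem le_fourth (h : P.IsCritical w θ c) (hQ : P.MixedTriangleFree) : c ≤ 1 / 4 := by
  by_contra! hc
  have hθ := h.half_le
  have hθ' := h.le_one
  have hdeg : ∀ s p v, P.red.Adj s p → P.blue.Adj s v →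
      wdeg P.red w s + wdeg P.blue w s + (wdeg P.red w v + wdeg P.blue w v) ≤ 1 := by
    intro s p v hp hv
    have hn : ∀ x, P.underlying.Adj s x → ¬ P.underlying.Adj v x := fun x =>
      hQ s p v hp hv v x (underlying_adj.mpr (.inr hv))
    rw [← add_assoc]
    refine h.four_le_one (fun x h1 h2 => P.not_red_and_blue h1 h2) ?_ ?_
    · intro x h1 h2
      exact hn x (underlying_adj.mpr h1) (underlying_adj.mpr (.inl h2))
    · rintro x (h1 | h1) h2
      · exact hn x (underlying_adj.mpr h1) (underlying_adj.mpr (.inr h2))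
      · exact P.not_red_and_blue h1 h2
  have hred : ∀ v, 0 < w v → 0 < wdeg P.red w v := by
    refine fun v hv => h.wdeg_red_pos hc ?_ hv
    intro s v hs hv hsv hrs
    by_contra hn
    have hv0 : wdeg P.red w v = 0 := le_antisymm (not_lt.mp hn) (wdeg_nonneg h.nonneg v)
    obtain ⟨u, hsu, -⟩ := exists_adj_of_wdeg_pos h.nonneg hrs
    have h1 := hdeg s u v hsu hsv
    have h2 := h.le_mul_deg hs
    have h3 := h.deg_eq v hv
    rw [hv0] at h1 h3
    set d := wdeg P.red w s + wdeg P.blue w s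
    have h5 : c ≤ (1 - θ) * (1 - d) := by
      have := mul_le_mul_of_nonneg_left (show wdeg P.blue w v ≤ 1 - d by linarith)
        (sub_nonneg.mpr hθ')
      linarith
    nlinarith [sq_nonneg (2 * θ - 1), mul_le_mul_of_nonneg_left h2 (sub_nonneg.mpr hθ'),
      mul_le_mul_of_nonneg_left h5 (by linarith : 0 ≤ θ)]
  set r := wdeg P.red w
  set b := wdeg P.blue w
  set E := wedges P.blue w with hE
  have hsum : ∑ s, ∑ v, w s * (w v * ind (P.blue.Adj s v)) * ((r s + b s) + (r v + b v)) ≤ E := by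
    rw [hE, wedges]
    refine Finset.sum_le_sum fun s _ => ?_
    rw [wdeg, Finset.mul_sum]
    refine Finset.sum_le_sum fun v _ => ?_
    have h0 : 0 ≤ w s * (w v * ind (P.blue.Adj s v)) :=
      mul_nonneg (h.nonneg s) (mul_nonneg (h.nonneg v) (ind_nonneg _))
    by_cases hsv : P.blue.Adj s v
    · rcases (h.nonneg s).eq_or_lt with hs | hs
      · rw [← hs]; simp
      · obtain ⟨p, hp, -⟩ := exists_adj_of_wdeg_pos h.nonneg (hred s hs)
        exact mul_le_of_le_one_right h0 (hdeg s p v hp hsv)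
    · rw [ind_of_not hsv]; simp
  have hsum1 : ∑ s, ∑ v, w s * (w v * ind (P.blue.Adj s v)) * (r s + b s) =
      ∑ s, w s * b s * (r s + b s) := by
    refine Finset.sum_congr rfl fun s _ => ?_
    rw [← Finset.sum_mul, ← Finset.mul_sum]
    rfl
  have hsum2 : ∑ s, ∑ v, w s * (w v * ind (P.blue.Adj s v)) * (r v + b v) =
      ∑ s, w s * b s * (r s + b s) := by
    rw [Finset.sum_comm, ← hsum1]
    refine Finset.sum_congr rfl fun s _ => Finset.sum_congr rfl fun v _ => ?_
    rw [P.blue.adj_comm]; ring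
  simp only [mul_add _ (r _ + b _), Finset.sum_add_distrib] at hsum
  rw [hsum1, hsum2] at hsum
  have hEb : E = ∑ s, w s * b s := rfl
  -- By `deg_eq`, `θ * (r s + b s) = c + (2 * θ - 1) * b s` on the support; here `2 * θ - 1 ≥ 0`, so
  -- a lower bound for the sum of squares helps.
  have hS : θ * ∑ s, w s * b s * (r s + b s) =
      c * E + (2 * θ - 1) * ∑ s, w s * (b s * b s) := by
    rw [hEb, Finset.mul_sum, Finset.mul_sum, Finset.mul_sum, ← Finset.sum_add_distrib]
    refine Finset.sum_congr rfl fun s _ => ?_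
    rcases (h.nonneg s).eq_or_lt with hs | hs
    · rw [← hs]; simp
    · have : θ * r s + (1 - θ) * b s = c := h.deg_eq s hs
      rw [← this]; ring
  have hCS : E * E ≤ ∑ s, w s * (b s * b s) := by
    have h1 : 0 ≤ ∑ s, w s * ((b s - E) * (b s - E)) :=
      Finset.sum_nonneg fun s _ => mul_nonneg (h.nonneg s) (mul_self_nonneg _)
    have h2 : ∑ s, w s * ((b s - E) * (b s - E)) =
        ∑ s, w s * (b s * b s) - 2 * E * ∑ s, w s * b s + E * E * ∑ s, w s := by
      rw [Finset.mul_sum, Finset.mul_sum, ← Finset.sum_sub_distrib, ← Finset.sum_add_distrib]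
      exact Finset.sum_congr rfl fun s _ => by ring
    rw [h.sum_eq, ← hEb] at h2
    linarith
  have hEc : c ≤ E := h.le_blue
  have h1 := mul_le_mul_of_nonneg_left hsum (by linarith : 0 ≤ θ)
  have h2 := mul_le_mul_of_nonneg_left hCS (by linarith : 0 ≤ 2 * θ - 1)
  have h3 : 2 * (c * E + (2 * θ - 1) * (E * E)) ≤ θ * E := by linarith
  have h4 : 2 * (c + (2 * θ - 1) * E) ≤ θ := by
    have hE0 : 0 < E := h.pos.trans_le hEc
    refine le_of_mul_le_mul_right (?_ : _ ≤ θ * E) hE0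
    linarith
  nlinarith [mul_le_mul_of_nonneg_left hEc (by linarith : 0 ≤ 2 * θ - 1)]

end IsCritical

theorem sum_mul_wdeg_comm (G : SimpleGraph K) (w μ : K → ℝ) :
    ∑ v, w v * wdeg G μ v = ∑ v, μ v * wdeg G w v := by
  simp only [wdeg, Finset.mul_sum]
  rw [Finset.sum_comm]
  refine Finset.sum_congr rfl fun v _ => Finset.sum_congr rfl fun u _ => ?_
  rw [G.adj_comm]; ring

theorem wdeg_combination (G : SimpleGraph K) (w μ : K → ℝ) (s t : ℝ) (v : K) :
    wdeg G (fun x => s * w x + t * μ x) v = s * wdeg G w v + t * wdeg G μ v := by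
  simp only [wdeg, Finset.mul_sum, ← Finset.sum_add_distrib]
  exact Finset.sum_congr rfl fun u _ => by ring

theorem wedges_combination (G : SimpleGraph K) (w μ : K → ℝ) (s t : ℝ) :
    wedges G (fun x => s * w x + t * μ x) =
      s ^ 2 * wedges G w + 2 * s * t * ∑ v, μ v * wdeg G w v + t ^ 2 * wedges G μ := by
  have h : wedges G (fun x => s * w x + t * μ x) =
      s ^ 2 * wedges G w + s * t * ∑ v, μ v * wdeg G w v + s * t * ∑ v, w v * wdeg G μ v +
        t ^ 2 * wedges G μ := by
    simp only [wedges, wdeg_combination, Finset.mul_sum, ← Finset.sum_add_distrib]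
    exact Finset.sum_congr rfl fun u _ => by ring
  rw [h, sum_mul_wdeg_comm G w μ]; ring

theorem wedges_nonneg {G : SimpleGraph K} {w : K → ℝ} (hw : ∀ v, 0 ≤ w v) : 0 ≤ wedges G w :=
  Finset.sum_nonneg fun v _ => mul_nonneg (hw v) (wdeg_nonneg hw v)

theorem continuous_wedges (G : SimpleGraph K) : Continuous (wedges G) := by
  unfold wedges wdeg
  fun_prop

/-- A convex set in the plane avoiding an open quadrant lies in a half plane avoiding it. -/
theorem exists_separating_weights {S : Set (ℝ × ℝ)} (hS : Convex ℝ S) (hne : S.Nonempty) {e : ℝ}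
    (h : ∀ p ∈ S, ¬(e < p.1 ∧ e < p.2)) :
    ∃ θ : ℝ, 0 ≤ θ ∧ θ ≤ 1 ∧ ∀ p ∈ S, θ * p.1 + (1 - θ) * p.2 ≤ e := by
  have hdisj : Disjoint (Set.Ioi e ×ˢ Set.Ioi e) S := by
    rw [Set.disjoint_left]
    intro p hp hp'
    exact h p hp' ⟨hp.1, hp.2⟩
  obtain ⟨f, u, hf, hu⟩ := geometric_hahn_banach_open ((convex_Ioi e).prod (convex_Ioi e))
    (isOpen_Ioi.prod isOpen_Ioi) hS hdisj
  set A := f (1, 0) with hA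
  set B := f (0, 1) with hB
  have hfp : ∀ a b : ℝ, f (a, b) = a * A + b * B := by
    intro a b
    have : ((a, b) : ℝ × ℝ) = a • (1, 0) + b • (0, 1) := by simp
    rw [this, map_add, map_smul, map_smul, smul_eq_mul, smul_eq_mul]
  have hq : ∀ a b : ℝ, 0 < a → 0 < b → (e + a) * A + (e + b) * B < u := by
    intro a b ha hb
    rw [← hfp]
    exact hf _ ⟨by simpa using ha, by simpa using hb⟩
  -- A linear functional bounded above on an upper quadrant has nonpositive coefficients.
  have hA0 : A ≤ 0 := by
    by_contra! hpos
    have h1 := hq (1 + |u - (e + 1) * B - (e + 1) * A| / A) 1 (by positivity) one_pos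
    have h2 : (e + (1 + |u - (e + 1) * B - (e + 1) * A| / A)) * A =
        (e + 1) * A + |u - (e + 1) * B - (e + 1) * A| := by field_simp; ring
    rw [h2] at h1
    linarith [le_abs_self (u - (e + 1) * B - (e + 1) * A)]
  have hB0 : B ≤ 0 := by
    by_contra! hpos
    have h1 := hq 1 (1 + |u - (e + 1) * B - (e + 1) * A| / B) one_pos (by positivity)
    have h2 : (e + (1 + |u - (e + 1) * B - (e + 1) * A| / B)) * B =
        (e + 1) * B + |u - (e + 1) * B - (e + 1) * A| := by field_simp; ring
    rw [h2] at h1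
    linarith [le_abs_self (u - (e + 1) * B - (e + 1) * A)]
  have hu' : ∀ p ∈ S, u ≤ p.1 * A + p.2 * B := fun p hp => by
    rw [← hfp]; exact hu p hp
  have hAB : A + B < 0 := by
    by_contra! h0
    have h1 : A = 0 := by linarith
    have h2 : B = 0 := by linarith
    obtain ⟨p, hp⟩ := hne
    have h3 := hu' p hp
    have h4 := hq 1 1 one_pos one_pos
    rw [h1, h2] at h3 h4
    linarith
  have heu : e * (A + B) ≤ u := by
    by_contra! hlt
    set δ := (e * (A + B) - u) / (2 * (-(A + B))) with hδ
    have hδ0 : 0 < δ := div_pos (by linarith) (by linarith)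
    have h1 := hq δ δ hδ0 hδ0
    have h2 : δ * (2 * (-(A + B))) = e * (A + B) - u := div_mul_cancel₀ _ (by linarith)
    nlinarith
  refine ⟨A / (A + B), div_nonneg_of_nonpos hA0 hAB.le, ?_, fun p hp => ?_⟩
  · rw [div_le_one_of_neg hAB]; linarith
  · have h1 := (heu.trans (hu' p hp))
    have h2 : A / (A + B) * p.1 + (1 - A / (A + B)) * p.2 = (p.1 * A + p.2 * B) / (A + B) := by
      field_simp [hAB.ne]; ring
    rw [h2, div_le_iff_of_neg hAB]
    exact h1

/-- Take `w` maximizing the smaller of the two color weights, with value `e`. No direction `μ`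
improves both colors to first order, so the convex set of pairs of derivatives is separated from a
quadrant by a functional `(θ, 1 - θ)`. Complementary slackness gives equality on the support; if `θ
< 1 / 2` the colors are exchanged. -/
theorem exists_critical_weights (P : BicoloredGraph K) {w₀ : K → ℝ} (hw₀ : w₀ ∈ stdSimplex ℝ K)
    {c₀ : ℝ} (hc₀ : 0 ≤ c₀) (hr : c₀ < wedges P.red w₀) (hb : c₀ < wedges P.blue w₀) :
    ∃ w c θ, c₀ < c ∧ (P.IsCritical w θ c ∨ P.swap.IsCritical w θ c) := by
  classical
  obtain ⟨w, hw, hmax⟩ := (isCompact_stdSimplex ℝ K).exists_isMaxOn ⟨w₀, hw₀⟩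
    ((continuous_wedges P.red).min (continuous_wedges P.blue)).continuousOn
  set e := min (wedges P.red w) (wedges P.blue w) with he
  have hce : c₀ < e := (lt_min hr hb).trans_le (hmax hw₀)
  have her : e ≤ wedges P.red w := min_le_left _ _
  have heb : e ≤ wedges P.blue w := min_le_right _ _
  let L : (K → ℝ) →ₗ[ℝ] ℝ × ℝ :=
    { toFun := fun μ => (∑ v, μ v * wdeg P.red w v, ∑ v, μ v * wdeg P.blue w v)
      map_add' := fun μ ν => by simp [add_mul, Finset.sum_add_distrib]
      map_smul' := fun a μ => by simp [mul_assoc, Finset.mul_sum] }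
  obtain ⟨θ, h0, h1, hθ⟩ := exists_separating_weights (S := L '' stdSimplex ℝ K) (e := e)
    ((convex_stdSimplex ℝ K).linear_image L) ⟨_, Set.mem_image_of_mem _ hw⟩ (by
      rintro _ ⟨μ, hμ, rfl⟩ ⟨h1, h2⟩
      change e < ∑ v, μ v * wdeg P.red w v at h1
      change e < ∑ v, μ v * wdeg P.blue w v at h2
      obtain ⟨η, hη, hη1, hη2⟩ : ∃ η > 0, e + η ≤ ∑ v, μ v * wdeg P.red w v ∧
          e + η ≤ ∑ v, μ v * wdeg P.blue w v :=
        ⟨min (∑ v, μ v * wdeg P.red w v) (∑ v, μ v * wdeg P.blue w v) - e,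
          sub_pos.mpr (lt_min h1 h2), by simp, by simp⟩
      -- Small enough that the linear gain `2 * t * (1 - t) * η` beats the quadratic loss `e * t ^
      -- 2`.
      set t := η / (η + e + 1) with ht
      have hden : 0 < η + e + 1 := by linarith
      have ht0 : 0 < t := div_pos hη hden
      have ht1 : t < 1 := by rw [ht, div_lt_one hden]; linarith
      have hte : t * (η + e + 1) = η := div_mul_cancel₀ _ hden.ne'
      have hμ' : (fun x => (1 - t) * w x + t * μ x) ∈ stdSimplex ℝ K :=
        convex_stdSimplex ℝ K hw hμ (by linarith) ht0.le (by ring)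
      have hpos : ∀ G : SimpleGraph K, e ≤ wedges G w → e + η ≤ ∑ v, μ v * wdeg G w v →
          e < wedges G (fun x => (1 - t) * w x + t * μ x) := by
        intro G hG1 hG2
        rw [wedges_combination]
        have a1 := mul_le_mul_of_nonneg_left hG1 (sq_nonneg (1 - t))
        have a2 := mul_le_mul_of_nonneg_left hG2
          (mul_nonneg (mul_nonneg zero_le_two (sub_nonneg.mpr ht1.le)) ht0.le)
        have a3 := mul_nonneg (sq_nonneg t) (wedges_nonneg (G := G) hμ.1)
        have a4 : 0 < t * (2 * (1 - t) * η - e * t) := by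
          refine mul_pos ht0 ?_
          have : 2 * (1 - t) * η - e * t = 2 * η * (1 - t) - e * t := by ring
          nlinarith [mul_pos ht0 hη]
        nlinarith
      have : _ ≤ e := hmax hμ'
      exact absurd (lt_min (hpos _ her hη1) (hpos _ heb hη2)) (not_lt.mpr this))
  -- The separating inequality at the vertices of the simplex.
  have hθv : ∀ v, θ * wdeg P.red w v + (1 - θ) * wdeg P.blue w v ≤ e := by
    intro v
    have := hθ _ (Set.mem_image_of_mem L (single_mem_stdSimplex ℝ v))
    simpa [L, Pi.single_apply] using this
  have hsum : ∑ v, w v * (e - (θ * wdeg P.red w v + (1 - θ) * wdeg P.blue w v)) ≤ 0 := by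
    have : ∑ v, w v * (e - (θ * wdeg P.red w v + (1 - θ) * wdeg P.blue w v)) =
        e * ∑ v, w v - (θ * wedges P.red w + (1 - θ) * wedges P.blue w) := by
      simp only [wedges, Finset.mul_sum, ← Finset.sum_add_distrib, ← Finset.sum_sub_distrib]
      exact Finset.sum_congr rfl fun u _ => by ring
    rw [this, hw.2]
    nlinarith [mul_le_mul_of_nonneg_left her h0, mul_le_mul_of_nonneg_left heb (sub_nonneg.mpr h1)]
  have hnn : ∀ v ∈ Finset.univ,
      0 ≤ w v * (e - (θ * wdeg P.red w v + (1 - θ) * wdeg P.blue w v)) :=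
    fun v _ => mul_nonneg (hw.1 v) (sub_nonneg.mpr (hθv v))
  have heq := (Finset.sum_eq_zero_iff_of_nonneg hnn).mp
    (le_antisymm hsum (Finset.sum_nonneg hnn))
  have hdeg : ∀ v, 0 < w v → θ * wdeg P.red w v + (1 - θ) * wdeg P.blue w v = e := by
    intro v hv
    rcases mul_eq_zero.mp (heq v (Finset.mem_univ v)) with h | h
    · exact absurd h hv.ne'
    · linarith
  rcases le_total (1 / 2) θ with hh | hh
  · exact ⟨w, e, θ, hce, .inl ⟨hw.1, hw.2, hdeg, her, heb, hc₀.trans_lt hce, hh, h1⟩⟩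
  · refine ⟨w, e, 1 - θ, hce, .inr ⟨hw.1, hw.2, fun v hv => ?_, heb, her, hc₀.trans_lt hce,
      by linarith, by linarith⟩⟩
    rw [← hdeg v hv]
    change (1 - θ) * wdeg P.blue w v + (1 - (1 - θ)) * wdeg P.red w v = _
    ring

theorem TriangleMonochromatic.min_wedges_le {P : BicoloredGraph K} (hP : P.TriangleMonochromatic)
    {w : K → ℝ} (hw : w ∈ stdSimplex ℝ K) :
    wedges P.red w ≤ 1 / 3 ∨ wedges P.blue w ≤ 1 / 3 := by
  by_contra! h
  obtain ⟨w', c, θ, hc, h | h⟩ := exists_critical_weights P hw (by norm_num) h.1 h.2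
  · exact hc.not_ge (h.le_third hP)
  · exact hc.not_ge (h.le_third hP.swap)

theorem MixedTriangleFree.min_wedges_le {P : BicoloredGraph K} (hP : P.MixedTriangleFree)
    {w : K → ℝ} (hw : w ∈ stdSimplex ℝ K) :
    wedges P.red w ≤ 1 / 4 ∨ wedges P.blue w ≤ 1 / 4 := by
  by_contra! h
  obtain ⟨w', c, θ, hc, h | h⟩ := exists_critical_weights P hw (by norm_num) h.1 h.2
  · exact hc.not_ge (h.le_fourth hP)
  · exact hc.not_ge (h.le_fourth hP.swap)

end Weights

end BicoloredGraph

namespace BicoloredGraph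

/-! ### Edge density of random samples with repetition, by the second moment. -/

section Sampling

open scoped BigOperators

variable {ι κ V : Type*} [Fintype ι] [Fintype κ] [Fintype V]

/-- The proportion of ordered pairs of vertices that are adjacent. -/
noncomputable def density (G : SimpleGraph V) : ℝ := 𝔼 a, 𝔼 b, ind (G.Adj a b)

theorem density_eq_sum (G : SimpleGraph V) :
    density G = (∑ a, ∑ b, ind (G.Adj a b)) / (Fintype.card V : ℝ) ^ 2 := by
  simp only [density, Fintype.expect_eq_sum_div_card]
  rw [← Finset.sum_div, div_div, sq]

theorem density_eq_wedges (G : SimpleGraph V) :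
    density G = wedges G fun _ => 1 / (Fintype.card V : ℝ) := by
  simp only [density, wedges, wdeg, Fintype.expect_eq_sum_div_card, Finset.sum_div]
  refine Finset.sum_congr rfl fun v _ => ?_
  rw [Finset.mul_sum]
  exact Finset.sum_congr rfl fun u _ => by ring

theorem uniform_mem_stdSimplex [Nonempty V] :
    (fun _ => 1 / (Fintype.card V : ℝ)) ∈ stdSimplex ℝ V := by
  refine ⟨fun _ => by positivity, ?_⟩
  simp

theorem density_nonneg (G : SimpleGraph V) : 0 ≤ density G := by
  rw [density_eq_wedges]
  exact wedges_nonneg fun _ => by positivity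

theorem expect_le_one {f : V → ℝ} (hf : ∀ v, f v ≤ 1) : 𝔼 v, f v ≤ 1 := by
  rw [Fintype.expect_eq_sum_div_card]
  refine div_le_one_of_le₀ ?_ (Nat.cast_nonneg _)
  calc ∑ v, f v ≤ ∑ _v : V, (1 : ℝ) := Finset.sum_le_sum fun v _ => hf v
    _ = _ := by simp

theorem density_le_one (G : SimpleGraph V) : density G ≤ 1 :=
  expect_le_one fun _ => expect_le_one fun _ => ind_le_one _

theorem expect_mono {f g : V → ℝ} (h : ∀ v, f v ≤ g v) : 𝔼 v, f v ≤ 𝔼 v, g v :=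
  Finset.expect_le_expect fun v _ => h v

theorem expect_ind_eq (i : V) : 𝔼 j, ind (i = j) = 1 / (Fintype.card V : ℝ) := by
  classical
  rw [Fintype.expect_eq_sum_div_card]
  simp [ind]

/-- Restricting a uniformly random function along an injection gives a uniformly random function. -/
theorem expect_comp_injective [Nonempty V] [DecidableEq ι] [DecidableEq κ] {j : ι → κ}
    (hj : Function.Injective j)
    (F : (ι → V) → ℝ) : 𝔼 φ : κ → V, F (φ ∘ j) = 𝔼 ψ : ι → V, F ψ := by
  classical
  let e : ι ⊕ ((Set.range j)ᶜ : Set κ) ≃ κ :=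
    (Equiv.sumCongr (Equiv.ofInjective j hj) (Equiv.refl _)).trans (Equiv.Set.sumCompl _)
  have he : ∀ i, e (Sum.inl i) = j i := fun i => by simp [e]
  let E : (κ → V) ≃ (ι → V) × (((Set.range j)ᶜ : Set κ) → V) :=
    (Equiv.arrowCongr e.symm (Equiv.refl V)).trans (Equiv.sumArrowEquivProdArrow _ _ _)
  rw [Fintype.expect_equiv E _ (fun p => F p.1)]
  · rw [← Finset.univ_product_univ, Finset.expect_product]
    simp
  · intro φ
    congr 1

theorem expect_pair [Nonempty V] [DecidableEq κ] {i j : κ} (hij : i ≠ j) (g : V → V → ℝ) :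
    𝔼 φ : κ → V, g (φ i) (φ j) = 𝔼 a, 𝔼 b, g a b := by
  have h : Function.Injective ![i, j] := by
    intro x y; fin_cases x <;> fin_cases y <;> simp [hij, hij.symm]
  have := expect_comp_injective (V := V) h fun ψ => g (ψ 0) (ψ 1)
  simp only [Function.comp_def, Matrix.cons_val_zero, Matrix.cons_val_one] at this
  rw [this, Fintype.expect_equiv (finTwoArrowEquiv V) _ (fun p : V × V => g p.1 p.2)
    (fun _ => by simp), ← Finset.univ_product_univ, Finset.expect_product]

theorem expect_two_pairs [Nonempty V] [DecidableEq κ] {i j i' j' : κ} (hij : i ≠ j)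
    (hij' : i' ≠ j') (h1 : i ≠ i') (h2 : i ≠ j') (h3 : j ≠ i') (h4 : j ≠ j') (g : V → V → ℝ) :
    𝔼 φ : κ → V, g (φ i) (φ j) * g (φ i') (φ j') = (𝔼 a, 𝔼 b, g a b) ^ 2 := by
  have h : Function.Injective (Sum.elim ![i, j] ![i', j']) := by
    rintro (x | x) (y | y) <;> fin_cases x <;> fin_cases y <;>
      simp [hij, hij.symm, hij', hij'.symm, h1, h2, h3, h4, h1.symm, h2.symm, h3.symm, h4.symm]
  have := expect_comp_injective (V := V) h fun ψ =>
    g (ψ (.inl 0)) (ψ (.inl 1)) * g (ψ (.inr 0)) (ψ (.inr 1))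
  simp only [Function.comp_def, Sum.elim_inl, Sum.elim_inr, Matrix.cons_val_zero,
    Matrix.cons_val_one] at this
  rw [this]
  refine (Fintype.expect_equiv (Equiv.sumArrowEquivProdArrow (Fin 2) (Fin 2) V) _
    (fun p => g (p.1 0) (p.1 1) * g (p.2 0) (p.2 1)) (fun _ => rfl)).trans ?_
  rw [← Finset.univ_product_univ, Finset.expect_product]
  have e : 𝔼 x : Fin 2 → V, g (x 0) (x 1) = 𝔼 a, 𝔼 b, g a b :=
    expect_pair (by decide : (0 : Fin 2) ≠ 1) g
  simp only [← Finset.mul_expect, ← Finset.expect_mul, e, sq]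

/-- The edge density of a random sample is concentrated. -/
theorem expect_sq_density_comap_sub_le [Nonempty V] [Nonempty κ] [DecidableEq κ]
    (G : SimpleGraph V) :
    𝔼 φ : κ → V, (density (G.comap φ) - density G) ^ 2 ≤ 8 / (Fintype.card κ : ℝ) := by
  set ρ := density G with hρ
  set k := (Fintype.card κ : ℝ) with hk
  have hk0 : 0 < k := by rw [hk]; exact_mod_cast Fintype.card_pos
  let g : κ → κ → (κ → V) → ℝ := fun i j φ => ind (G.Adj (φ i) (φ j))
  have hD : ∀ φ : κ → V, density (G.comap φ) = 𝔼 i, 𝔼 j, g i j φ := fun φ => rfl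
  have hg0 : ∀ i j φ, 0 ≤ g i j φ := fun _ _ _ => ind_nonneg _
  have hg1 : ∀ i j φ, g i j φ ≤ 1 := fun _ _ _ => ind_le_one _
  -- Only the diagonal index pairs, a proportion `1 / k`, deviate from `ρ`.
  have m1 : ρ - 1 / k ≤ 𝔼 φ : κ → V, density (G.comap φ) := by
    have h : ∀ i j, ρ - ind (i = j) ≤ 𝔼 φ, g i j φ := by
      intro i j
      by_cases hij : i = j
      · rw [ind_of hij]
        exact (sub_nonpos.mpr (density_le_one G)).trans
          (Finset.expect_nonneg fun φ _ => hg0 i j φ)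
      · rw [ind_of_not hij, sub_zero]
        exact (expect_pair hij fun a b => ind (G.Adj a b)).ge
    calc ρ - 1 / k = 𝔼 i : κ, 𝔼 j : κ, (ρ - ind (i = j)) := by
          simp only [Finset.expect_sub_distrib, Fintype.expect_const, expect_ind_eq]; rfl
      _ ≤ 𝔼 i, 𝔼 j, 𝔼 φ, g i j φ := expect_mono fun i => expect_mono fun j => h i j
      _ = 𝔼 i, 𝔼 φ, 𝔼 j, g i j φ := by
          exact Finset.expect_congr rfl fun i _ => Finset.expect_comm _ _ _
      _ = 𝔼 φ, density (G.comap φ) := by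
          rw [Finset.expect_comm]; rfl
  -- Two index pairs without coincidences are independent; each of the six possible coincidences
  -- costs `1 / k`.
  have m2 : 𝔼 φ : κ → V, density (G.comap φ) ^ 2 ≤ ρ ^ 2 + 6 / k := by
    have h : ∀ i j i' j', 𝔼 φ, g i j φ * g i' j' φ ≤ ρ ^ 2 + ind (i = j) + ind (i' = j') +
        ind (i = i') + ind (i = j') + ind (j = i') + ind (j = j') := by
      intro i j i' j'
      have htriv : 𝔼 φ, g i j φ * g i' j' φ ≤ 1 :=
        expect_le_one fun φ => mul_le_one₀ (hg1 _ _ _) (hg0 _ _ _) (hg1 _ _ _)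
      by_cases hall : i ≠ j ∧ i' ≠ j' ∧ i ≠ i' ∧ i ≠ j' ∧ j ≠ i' ∧ j ≠ j'
      · obtain ⟨a1, a2, a3, a4, a5, a6⟩ := hall
        have := expect_two_pairs (V := V) a1 a2 a3 a4 a5 a6 fun a b => ind (G.Adj a b)
        rw [ind_of_not a1, ind_of_not a2, ind_of_not a3, ind_of_not a4, ind_of_not a5,
          ind_of_not a6]
        simp only [add_zero]
        exact this.le
      · refine htriv.trans ?_
        have n0 := sq_nonneg ρ
        have n1 := ind_nonneg (i = j)
        have n2 := ind_nonneg (i' = j')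
        have n3 := ind_nonneg (i = i')
        have n4 := ind_nonneg (i = j')
        have n5 := ind_nonneg (j = i')
        have n6 := ind_nonneg (j = j')
        have : i = j ∨ i' = j' ∨ i = i' ∨ i = j' ∨ j = i' ∨ j = j' := by tauto
        rcases this with h | h | h | h | h | h <;>
        · have := ind_of h
          linarith
    calc 𝔼 φ : κ → V, density (G.comap φ) ^ 2
        = 𝔼 φ, 𝔼 i, 𝔼 j, 𝔼 i', 𝔼 j', g i j φ * g i' j' φ := by
          refine Finset.expect_congr rfl fun φ _ => ?_
          rw [hD, sq, Finset.expect_mul]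
          refine Finset.expect_congr rfl fun i _ => ?_
          rw [Finset.expect_mul]
          refine Finset.expect_congr rfl fun j _ => ?_
          rw [Finset.mul_expect]
          exact Finset.expect_congr rfl fun i' _ => by rw [Finset.mul_expect]
      _ = 𝔼 i, 𝔼 j, 𝔼 i', 𝔼 j', 𝔼 φ, g i j φ * g i' j' φ := by
          rw [Finset.expect_comm]
          refine Finset.expect_congr rfl fun i _ => ?_
          rw [Finset.expect_comm]
          refine Finset.expect_congr rfl fun j _ => ?_
          rw [Finset.expect_comm]
          refine Finset.expect_congr rfl fun i' _ => ?_
          rw [Finset.expect_comm]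
      _ ≤ 𝔼 i : κ, 𝔼 j : κ, 𝔼 i' : κ, 𝔼 j' : κ, (ρ ^ 2 + ind (i = j) + ind (i' = j') +
            ind (i = i') + ind (i = j') + ind (j = i') + ind (j = j')) :=
          expect_mono fun i => expect_mono fun j => expect_mono fun i' => expect_mono fun j' =>
            h i j i' j'
      _ = ρ ^ 2 + 6 / k := by
          simp only [Finset.expect_add_distrib, Fintype.expect_const, expect_ind_eq]
          rw [← hk]; ring
  have hexp : 𝔼 φ : κ → V, (density (G.comap φ) - ρ) ^ 2 =
      𝔼 φ : κ → V, density (G.comap φ) ^ 2 - 2 * ρ * 𝔼 φ : κ → V, density (G.comap φ) +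
        ρ ^ 2 := by
    rw [Finset.mul_expect, ← Finset.expect_sub_distrib,
      ← Fintype.expect_const (ι := κ → V) (ρ ^ 2), ← Finset.expect_add_distrib]
    refine Finset.expect_congr rfl fun φ _ => ?_
    ring
  rw [hexp]
  have h0 : 0 ≤ ρ := density_nonneg G
  have h1 : ρ ≤ 1 := density_le_one G
  have h2 := mul_le_mul_of_nonneg_left m1 (by linarith : 0 ≤ 2 * ρ)
  have h3 : ρ * (1 / k) ≤ 1 * (1 / k) := mul_le_mul_of_nonneg_right h1 (by positivity)
  have h4 : 8 / k = 6 / k + 2 * (1 * (1 / k)) := by ring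
  rw [h4]
  nlinarith

open Classical in
/-- Few samples have edge density far from that of the whole graph. -/
theorem card_density_comap_le [Nonempty V] [Nonempty κ] [DecidableEq κ] (G : SimpleGraph V)
    {δ β : ℝ} (hδ : 0 < δ) (hβ : β + δ ≤ density G) (hk : 32 / δ ^ 2 ≤ Fintype.card κ) :
    ((Finset.univ.filter fun φ : κ → V => density (G.comap φ) ≤ β).card : ℝ) ≤
      Fintype.card (κ → V) / 4 := by
  have h := expect_sq_density_comap_sub_le (κ := κ) G
  rw [Fintype.expect_eq_sum_div_card, div_le_iff₀ (by exact_mod_cast Fintype.card_pos)] at h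
  have hk0 : (0 : ℝ) < Fintype.card κ := by exact_mod_cast Fintype.card_pos
  have h1 : ((Finset.univ.filter fun φ : κ → V => density (G.comap φ) ≤ β).card : ℝ) * δ ^ 2 ≤
      ∑ φ : κ → V, (density (G.comap φ) - density G) ^ 2 := by
    rw [← nsmul_eq_mul, ← Finset.sum_const]
    refine (Finset.sum_le_sum fun φ hφ => ?_).trans
      (Finset.sum_le_sum_of_subset_of_nonneg (Finset.subset_univ _) fun _ _ _ => sq_nonneg _)
    have := (Finset.mem_filter.mp hφ).2
    nlinarith
  -- The constant 32 makes Chebyshev's bound equal to a quarter, so that two colors together spoil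
  -- at most half of the samples.
  have h2 : (8 : ℝ) / Fintype.card κ ≤ δ ^ 2 / 4 := by
    rw [div_le_iff₀ (by positivity)] at hk
    rw [div_le_iff₀ hk0]
    linarith
  have h3 : (0 : ℝ) ≤ Fintype.card (κ → V) := Nat.cast_nonneg _
  refine le_of_mul_le_mul_right (?_ : _ * δ ^ 2 ≤ _ * δ ^ 2) (by positivity)
  nlinarith [mul_le_mul_of_nonneg_right h2 h3]

end Sampling

/-! ### From many copies of a pattern to a blow-up. -/

section Blowup

-- Greedy choice in the manner of Kővári–Sós–Turán: since `T` stays below half of the guaranteed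
-- degree, averaging finds a new vertex related to at least a `c / 2` fraction of the surviving set.
open Classical in
theorem exists_common_neighbors {V X : Type*} [Fintype V] (r : V → X → Prop) {Y : Finset X}
    (hY : Y.Nonempty) {c : ℝ} (hc : 0 < c)
    (hr : ∀ x ∈ Y, c * Fintype.card V ≤ (Finset.univ.filter fun v => r v x).card) (t : ℕ)
    (ht : 2 * (t : ℝ) ≤ c * Fintype.card V) :
    ∃ T : Finset V, T.card = t ∧ ∃ Y' ⊆ Y, (c / 2) ^ t * Y.card ≤ Y'.card ∧
      ∀ x ∈ Y', ∀ v ∈ T, r v x := by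
  induction t with
  | zero => exact ⟨∅, rfl, Y, subset_rfl, by simp, by simp⟩
  | succ t ih =>
    push_cast at ht
    obtain ⟨T, hT, Y', hY', hcard, hall⟩ := ih (by linarith)
    have hY0 : (0 : ℝ) < Y'.card :=
      lt_of_lt_of_le (mul_pos (pow_pos (by linarith) _) (by exact_mod_cast hY.card_pos)) hcard
    obtain ⟨v, hvT, hv⟩ : ∃ v, v ∉ T ∧
        c / 2 * Y'.card ≤ (Y'.filter fun x => r v x).card := by
      by_contra! hcon
      have h1 : ∑ v ∈ Tᶜ, ((Y'.bipartiteAbove r v).card : ℝ) =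
          ∑ x ∈ Y', ((Tᶜ.bipartiteBelow r x).card : ℝ) := by
        exact_mod_cast Finset.sum_card_bipartiteAbove_eq_sum_card_bipartiteBelow r
      have h2 : ∑ v ∈ Tᶜ, ((Y'.bipartiteAbove r v).card : ℝ) ≤
          Fintype.card V * (c / 2 * Y'.card) := by
        calc _ ≤ ∑ _v ∈ Tᶜ, c / 2 * (Y'.card : ℝ) :=
              Finset.sum_le_sum fun v hv => (hcon v (Finset.mem_compl.mp hv)).le
          _ = (Tᶜ.card : ℝ) * (c / 2 * Y'.card) := by rw [Finset.sum_const, nsmul_eq_mul]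
          _ ≤ _ := by
            refine mul_le_mul_of_nonneg_right ?_ (by positivity)
            exact_mod_cast Finset.card_le_univ _
      have h3 : Y'.card * (c * Fintype.card V - t) ≤
          ∑ x ∈ Y', ((Tᶜ.bipartiteBelow r x).card : ℝ) := by
        rw [← nsmul_eq_mul, ← Finset.sum_const]
        refine Finset.sum_le_sum fun x hx => ?_
        have hsub : (Finset.univ.filter fun v => r v x) ⊆ Tᶜ.bipartiteBelow r x ∪ T := by
          intro v hv
          simp only [Finset.mem_union, Finset.mem_bipartiteBelow, Finset.mem_compl]
          by_cases hvT : v ∈ T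
          · exact .inr hvT
          · exact .inl ⟨hvT, (Finset.mem_filter.mp hv).2⟩
        have hle := (Finset.card_le_card hsub).trans (Finset.card_union_le _ _)
        rw [hT] at hle
        have hle' : ((Finset.univ.filter fun v => r v x).card : ℝ) ≤
            (Tᶜ.bipartiteBelow r x).card + t := by exact_mod_cast hle
        linarith [hr x (hY' hx)]
      nlinarith
    refine ⟨insert v T, by rw [Finset.card_insert_of_notMem hvT, hT],
      Y'.filter fun x => r v x, (Finset.filter_subset _ _).trans hY', ?_, ?_⟩
    · calc (c / 2) ^ (t + 1) * (Y.card : ℝ) = c / 2 * ((c / 2) ^ t * Y.card) := by ring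
        _ ≤ c / 2 * Y'.card := mul_le_mul_of_nonneg_left hcard (by linarith)
        _ ≤ _ := hv
    · intro x hx u hu
      rw [Finset.mem_filter] at hx
      rcases Finset.mem_insert.mp hu with rfl | hu
      · exact hx.2
      · exact hall x hx.1 u hu

open Classical in
/-- A dense set of `q`-tuples contains a product of `q` large sets. -/
theorem exists_product_subset (q t : ℕ) {c : ℝ} (hc : 0 < c) :
    ∃ N : ℕ, ∀ n ≥ N, ∀ E : Finset (Fin q → Fin n), c * (n : ℝ) ^ q ≤ E.card →
      ∃ A : Fin q → Finset (Fin n), (∀ i, (A i).card = t) ∧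
        ∀ ψ : Fin q → Fin n, (∀ i, ψ i ∈ A i) → ψ ∈ E := by
  induction q generalizing c with
  | zero =>
    refine ⟨0, fun n _ E hE => ⟨fun i => i.elim0, fun i => i.elim0, fun ψ _ => ?_⟩⟩
    have hpos : 0 < E.card := by
      have : (0 : ℝ) < E.card := lt_of_lt_of_le (by simpa using hc) hE
      exact_mod_cast this
    obtain ⟨ψ', h⟩ := Finset.card_pos.mp hpos
    rwa [Subsingleton.elim ψ ψ']
  | succ q ih =>
    -- At least `c / 2 * n ^ q` tails have `c / 2 * n` heads each; fixing `t` common heads keeps a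
    -- `(c / 4) ^ t` fraction of these tails.
    obtain ⟨N, hN⟩ := ih (c := (c / 4) ^ t * (c / 2)) (by positivity)
    refine ⟨max (N + 1) ⌈4 * t / c⌉₊, fun n hn E hE => ?_⟩
    have hnN : N ≤ n := by have := le_of_max_le_left hn; omega
    have hn0 : (0 : ℝ) < n := by have := le_of_max_le_left hn; exact_mod_cast (by omega : 0 < n)
    have hnt : 2 * (t : ℝ) ≤ c / 2 * n := by
      have h1 : 4 * t / c ≤ (n : ℝ) := Nat.ceil_le.mp (le_of_max_le_right hn)
      rw [div_le_iff₀ hc] at h1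
      linarith
    let r : Fin n → (Fin q → Fin n) → Prop := fun v x => Fin.cons v x ∈ E
    let d : (Fin q → Fin n) → ℕ := fun x => (Finset.univ.filter fun v => r v x).card
    have hsum : (E.card : ℝ) = ∑ x, (d x : ℝ) := by
      have h1 : E.card = (Finset.univ.filter fun p : Fin n × (Fin q → Fin n) => r p.1 p.2).card := by
        refine Finset.card_equiv (Fin.consEquiv fun _ => Fin n).symm fun ψ => ?_
        simp [r, Fin.consEquiv]
      have h2 : E.card = ∑ x, d x := by
        rw [h1, Finset.card_filter, ← Finset.univ_product_univ, Finset.sum_product_right]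
        simp only [d, Finset.card_filter]
      exact_mod_cast h2
    set Y := Finset.univ.filter fun x => c / 2 * n ≤ d x with hYdef
    have hY : c / 2 * (n : ℝ) ^ q ≤ Y.card := by
      have h1 : ∑ x, (d x : ℝ) ≤ ∑ x : Fin q → Fin n, (c / 2 * n + if x ∈ Y then (n : ℝ) else 0) := by
        refine Finset.sum_le_sum fun x _ => ?_
        by_cases hx : x ∈ Y
        · rw [if_pos hx]
          have : d x ≤ n := (Finset.card_le_univ _).trans_eq (Fintype.card_fin n)
          have : (d x : ℝ) ≤ n := by exact_mod_cast this
          have : 0 ≤ c / 2 * n := by positivity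
          linarith
        · rw [if_neg hx, add_zero]
          simp only [hYdef, Finset.mem_filter, Finset.mem_univ, true_and, not_le] at hx
          exact hx.le
      rw [Finset.sum_add_distrib, Finset.sum_const, ← Finset.sum_filter, Finset.sum_const,
        Finset.filter_mem_eq_inter, Finset.univ_inter, nsmul_eq_mul, nsmul_eq_mul,
        Finset.card_univ, Fintype.card_fun, Fintype.card_fin, Fintype.card_fin, ← hsum] at h1
      push_cast at h1
      have h2 := hE.trans h1
      rw [pow_succ] at h2
      have h3 : c / 2 * (n : ℝ) ^ q * n ≤ Y.card * n := by linarith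
      exact le_of_mul_le_mul_right h3 hn0
    have hYne : Y.Nonempty := by
      rw [← Finset.card_pos]
      have : (0 : ℝ) < Y.card := lt_of_lt_of_le (by positivity) hY
      exact_mod_cast this
    obtain ⟨T, hT, Y', -, hcard, hall⟩ := exists_common_neighbors r hYne (c := c / 2)
      (by positivity) (fun x hx => by
        rw [Fintype.card_fin]; convert (Finset.mem_filter.mp hx).2) t (by rwa [Fintype.card_fin])
    obtain ⟨A, hA, hAE⟩ := hN n hnN Y' (by
      refine le_trans ?_ hcard
      rw [mul_assoc, show c / 2 / 2 = c / 4 by ring]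
      exact mul_le_mul_of_nonneg_left hY (by positivity))
    refine ⟨Fin.cons T A, fun i => ?_, fun ψ hψ => ?_⟩
    · refine Fin.cases ?_ (fun i => ?_) i
      · simpa using hT
      · simpa using hA i
    · have h1 : Fin.tail ψ ∈ Y' := hAE _ fun i => by simpa [Fin.tail] using hψ i.succ
      have h2 := hall _ h1 (ψ 0) (by simpa using hψ 0)
      simpa [r] using h2

/-- A graph containing a large blow-up of a homomorphic image of `H` contains `H`. -/
theorem contains_of_product {V W : Type*} [Fintype V] {q : ℕ} {H : BicoloredGraph V}
    {P : BicoloredGraph (Fin q)} {G : BicoloredGraph W} (hHP : H.HasHom P)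
    {A : Fin q → Finset W} (hA : ∀ i, (A i).card = Fintype.card V + 1)
    (hAP : ∀ ψ : Fin q → W, (∀ i, ψ i ∈ A i) →
      (∀ i j, P.red.Adj i j → G.red.Adj (ψ i) (ψ j)) ∧
      ∀ i j, P.blue.Adj i j → G.blue.Adj (ψ i) (ψ j)) : G.Contains H := by
  classical
  obtain ⟨h, hr, hb⟩ := hHP
  -- The sets `A i` may overlap, so distinct images are chosen by Hall's theorem, each set being
  -- larger than `V`.
  obtain ⟨f, hf, hfA⟩ := (Finset.all_card_le_biUnion_card_iff_exists_injective
    fun v => A (h v)).mp (by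
      intro s
      rcases s.eq_empty_or_nonempty with rfl | ⟨v, hv⟩
      · simp
      · calc s.card ≤ Fintype.card V := Finset.card_le_univ s
          _ ≤ (A (h v)).card := by rw [hA]; omega
          _ ≤ _ := Finset.card_le_card (Finset.subset_biUnion_of_mem (fun v => A (h v)) hv))
  have hne : ∀ i, ∃ x, x ∈ A i := fun i => Finset.card_pos.mp (by rw [hA]; omega)
  choose x hx using hne
  have key : ∀ u v, h u ≠ h v → ∃ ψ : Fin q → W, (∀ i, ψ i ∈ A i) ∧ ψ (h u) = f u ∧
      ψ (h v) = f v := by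
    intro u v huv
    refine ⟨Function.update (Function.update x (h u) (f u)) (h v) (f v), fun i => ?_, ?_, ?_⟩
    · by_cases h1 : i = h v
      · subst h1; simpa using hfA v
      · by_cases h2 : i = h u
        · subst h2; simpa [h1] using hfA u
        · simpa [h1, h2] using hx i
    · simp [huv]
    · simp
  refine ⟨⟨f, hf⟩, fun u v huv => ?_, fun u v huv => ?_⟩
  · obtain ⟨ψ, hψ, h1, h2⟩ := key u v (hr u v huv).ne
    have := (hAP ψ hψ).1 _ _ (hr u v huv)
    rwa [h1, h2] at this
  · obtain ⟨ψ, hψ, h1, h2⟩ := key u v (hb u v huv).ne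
    have := (hAP ψ hψ).2 _ _ (hb u v huv)
    rwa [h1, h2] at this

/-- The bicolored graph induced along a map. -/
def pullback {V W : Type*} (G : BicoloredGraph W) (φ : V → W) : BicoloredGraph V where
  red := G.red.comap φ
  blue := G.blue.comap φ
  disjoint := by
    rw [SimpleGraph.disjoint_left]
    exact fun u v h1 h2 => G.not_red_and_blue h1 h2

/-- If `H` or its swap maps into every finite bicolored graph whose color densities exceed `β`,
then large graphs with color densities at least `β + δ` contain `H` or its swap. -/
theorem exists_forall_contains {V : Type*} [Fintype V] (H : BicoloredGraph V) {β : ℝ}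
    (hH : ∀ (k : ℕ) (P : BicoloredGraph (Fin (k + 1))), β < density P.red → β < density P.blue →
      H.HasHom P ∨ H.swap.HasHom P) {δ : ℝ} (hδ : 0 < δ) :
    ∃ N : ℕ, ∀ n ≥ N, ∀ G : BicoloredGraph (Fin n), β + δ ≤ density G.red →
      β + δ ≤ density G.blue → G.Contains H ∨ G.Contains H.swap := by
  classical
  set k := ⌈32 / δ ^ 2⌉₊ with hk
  have hkδ : 32 / δ ^ 2 ≤ (Fintype.card (Fin (k + 1)) : ℝ) := by
    rw [Fintype.card_fin]; push_cast
    exact (Nat.le_ceil _).trans (by linarith)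
  let S := SimpleGraph (Fin (k + 1)) × SimpleGraph (Fin (k + 1))
  let _ : Fintype S := Fintype.ofFinite _
  have hS : (0 : ℝ) < Fintype.card S := by
    have : Nonempty S := ⟨(⊥, ⊥)⟩
    exact_mod_cast Fintype.card_pos
  obtain ⟨N, hN⟩ := exists_product_subset (k + 1) (Fintype.card V + 1)
    (c := 1 / 2 / Fintype.card S) (by positivity)
  refine ⟨N + 1, fun n hn G hr hb => ?_⟩
  have : Nonempty (Fin n) := ⟨⟨0, by omega⟩⟩
  set total : ℝ := (Fintype.card (Fin (k + 1) → Fin n) : ℝ) with htotal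
  let good : Finset (Fin (k + 1) → Fin n) := Finset.univ.filter fun φ =>
    β < density (G.red.comap φ) ∧ β < density (G.blue.comap φ)
  have hgood : total / 2 ≤ good.card := by
    have h1 := card_density_comap_le (κ := Fin (k + 1)) G.red hδ hr hkδ
    have h2 := card_density_comap_le (κ := Fin (k + 1)) G.blue hδ hb hkδ
    have hsub : (Finset.univ : Finset (Fin (k + 1) → Fin n)) ⊆
        (good ∪ Finset.univ.filter fun φ => density (G.red.comap φ) ≤ β) ∪
          Finset.univ.filter fun φ => density (G.blue.comap φ) ≤ β := by
      intro φ _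
      simp only [good, Finset.mem_union, Finset.mem_filter, Finset.mem_univ, true_and]
      by_cases h1 : density (G.red.comap φ) ≤ β
      · exact .inl (.inr h1)
      · by_cases h2 : density (G.blue.comap φ) ≤ β
        · exact .inr h2
        · exact .inl (.inl ⟨not_le.mp h1, not_le.mp h2⟩)
    have h3 := (Finset.card_le_card hsub).trans ((Finset.card_union_le _ _).trans
      (Nat.add_le_add_right (Finset.card_union_le _ _) _))
    rw [Finset.card_univ] at h3
    have h4 : total ≤ good.card +
        (Finset.univ.filter fun φ : Fin (k + 1) → Fin n => density (G.red.comap φ) ≤ β).card +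
        (Finset.univ.filter fun φ : Fin (k + 1) → Fin n => density (G.blue.comap φ) ≤ β).card := by
      rw [htotal]
      exact_mod_cast h3
    linarith
  let pat : (Fin (k + 1) → Fin n) → S := fun φ => (G.red.comap φ, G.blue.comap φ)
  -- Pigeonhole: the number of patterns on `k + 1` points does not depend on `n`.
  obtain ⟨s, hs⟩ : ∃ s : S, 1 / 2 / Fintype.card S * total ≤
      (good.filter fun φ => pat φ = s).card := by
    by_contra! hcon
    have h1 : (good.card : ℝ) = ∑ s : S, ((good.filter fun φ => pat φ = s).card : ℝ) := by
      exact_mod_cast Finset.card_eq_sum_card_fiberwise fun φ _ => Finset.mem_univ (pat φ)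
    have h2 : ∑ s : S, ((good.filter fun φ => pat φ = s).card : ℝ) <
        ∑ _s : S, 1 / 2 / Fintype.card S * total :=
      Finset.sum_lt_sum_of_nonempty ⟨(⊥, ⊥), Finset.mem_univ _⟩ fun s _ => hcon s
    rw [Finset.sum_const, nsmul_eq_mul, Finset.card_univ] at h2
    have h3 : (Fintype.card S : ℝ) * (1 / 2 / Fintype.card S * total) = total / 2 := by
      field_simp
    linarith
  have htot : total = (n : ℝ) ^ (k + 1) := by
    rw [htotal, Fintype.card_fun, Fintype.card_fin, Fintype.card_fin]; push_cast; rfl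
  rw [htot] at hs
  have hpos : 0 < (good.filter fun φ => pat φ = s).card := by
    have hn0 : (0 : ℝ) < n := by exact_mod_cast (by omega : 0 < n)
    have : (0 : ℝ) < (good.filter fun φ => pat φ = s).card := lt_of_lt_of_le (by positivity) hs
    exact_mod_cast this
  obtain ⟨φ, hφ⟩ := Finset.card_pos.mp hpos
  simp only [good, Finset.mem_filter, Finset.mem_univ, true_and] at hφ
  obtain ⟨A, hA, hAE⟩ := hN n (by omega) _ hs
  have hAP : ∀ ψ : Fin (k + 1) → Fin n, (∀ i, ψ i ∈ A i) →
      (∀ i j, (G.pullback φ).red.Adj i j → G.red.Adj (ψ i) (ψ j)) ∧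
      ∀ i j, (G.pullback φ).blue.Adj i j → G.blue.Adj (ψ i) (ψ j) := by
    intro ψ hψ
    have h1 : pat ψ = pat φ := ((Finset.mem_filter.mp (hAE ψ hψ)).2).trans hφ.2.symm
    have hr' : G.red.comap ψ = G.red.comap φ := congrArg Prod.fst h1
    have hb' : G.blue.comap ψ = G.blue.comap φ := congrArg Prod.snd h1
    refine ⟨fun i j hij => ?_, fun i j hij => ?_⟩
    · change (G.red.comap φ).Adj i j at hij
      rw [← hr'] at hij; exact hij
    · change (G.blue.comap φ).Adj i j at hij
      rw [← hb'] at hij; exact hij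
  exact (hH k (G.pullback φ) hφ.1.1 hφ.1.2).imp (fun h => contains_of_product h hA hAP)
    (fun h => contains_of_product h hA hAP)

end Blowup

end BicoloredGraph

namespace BicoloredGraph

/-! ### From densities to the extremal function. -/

section EdgeCounts

theorem sum_ind_adj {V : Type*} [Fintype V] (G : SimpleGraph V) :
    ∑ a, ∑ b, ind (G.Adj a b) = 2 * (G.edgeSet.ncard : ℝ) := by
  classical
  have h1 : ∀ a, ∑ b, ind (G.Adj a b) = (G.degree a : ℝ) := by
    intro a
    rw [← SimpleGraph.card_neighborFinset_eq_degree, SimpleGraph.neighborFinset_eq_filter,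
      Finset.card_filter]
    push_cast
    exact Finset.sum_congr rfl fun b _ => by by_cases h : G.Adj a b <;> simp [ind, h]
  have h2 : G.edgeSet.ncard = G.edgeFinset.card := by
    rw [Set.ncard_eq_toFinset_card', SimpleGraph.edgeFinset]
  simp only [h1]
  rw [h2]
  exact_mod_cast G.sum_degrees_eq_twice_card_edges

theorem density_eq_ncard {V : Type*} [Fintype V] (G : SimpleGraph V) :
    density G = 2 * (G.edgeSet.ncard : ℝ) / (Fintype.card V : ℝ) ^ 2 := by
  rw [density_eq_sum, sum_ind_adj]

theorem edgeCount_eq {V : Type*} [Finite V] (G : BicoloredGraph V) :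
    G.edgeCount = G.red.edgeSet.ncard + G.blue.edgeSet.ncard := by
  rw [edgeCount, underlying, SimpleGraph.edgeSet_sup, Set.ncard_union_eq]
  · exact SimpleGraph.disjoint_edgeSet.mpr G.disjoint

theorem choose_two_cast (n : ℕ) : (n.choose 2 : ℝ) = n * (n - 1) / 2 := Nat.cast_choose_two ℝ n

/-- Upper bound on the extremal function from homomorphisms into dense bicolored graphs. -/
theorem eventually_ex_lt {V : Type*} [Fintype V] (H : BicoloredGraph V) {β : ℝ} (hβ0 : 0 ≤ β)
    (hβ1 : β ≤ 1)
    (hH : ∀ (k : ℕ) (P : BicoloredGraph (Fin (k + 1))), β < density P.red → β < density P.blue →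
      H.HasHom P ∨ H.swap.HasHom P) {a : ℝ} (ha : 2 * β < a) :
    ∀ᶠ n : ℕ in atTop, (ex (1 / 2) n (colorClosure H) : ℝ) / (n.choose 2 : ℝ) < a := by
  -- For `β, δ ≤ 1` one has `2 * (β + δ) * (1 + δ) ≤ 2 * β + 6 * δ`; the factor `1 + δ` pays for
  -- replacing `n ^ 2` by `n * (n - 1)`.
  obtain ⟨δ, hδ, hδ1, hδa⟩ : ∃ δ : ℝ, 0 < δ ∧ δ ≤ 1 ∧ 6 * δ < a - 2 * β :=
    ⟨min 1 ((a - 2 * β) / 7), lt_min one_pos (by linarith), min_le_left _ _, by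
      have := min_le_right 1 ((a - 2 * β) / 7); linarith⟩
  obtain ⟨N, hN⟩ := exists_forall_contains H hH hδ
  filter_upwards [eventually_ge_atTop N, eventually_ge_atTop (2 + ⌈1 / δ⌉₊)] with n hnN hn
  have hn' : 1 / δ + 2 ≤ (n : ℝ) := by
    have h1 := Nat.le_ceil (1 / δ)
    have h2 : ((2 + ⌈1 / δ⌉₊ : ℕ) : ℝ) ≤ n := by exact_mod_cast hn
    push_cast at h2; linarith
  have hδ' : 0 < 1 / δ := by positivity
  have hn0 : 0 < (n : ℝ) := by linarith
  have hle : (ex (1 / 2) n (colorClosure H) : ℝ) ≤ (β + δ) * (n : ℝ) ^ 2 := by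
    have hub : ∀ m ∈ avoidingEdgeCounts (1 / 2) n (colorClosure H),
        m ≤ ⌊(β + δ) * (n : ℝ) ^ 2⌋₊ := by
      rintro m ⟨G, ⟨hr, hb⟩, hG, rfl⟩
      refine Nat.le_floor ?_
      by_contra! hlt
      have he : (G.edgeCount : ℝ) = G.red.edgeSet.ncard + G.blue.edgeSet.ncard := by
        exact_mod_cast G.edgeCount_eq
      have hd : ∀ x : ℝ, 1 / 2 * (G.edgeCount : ℝ) ≤ x → β + δ ≤ 2 * x / (n : ℝ) ^ 2 := by
        intro x hx
        rw [le_div_iff₀ (by positivity)]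
        linarith
      rcases hN n hnN G (by rw [density_eq_ncard, Fintype.card_fin]; exact hd _ hr)
        (by rw [density_eq_ncard, Fintype.card_fin]; exact hd _ hb) with h | h
      · exact hG H (by simp [colorClosure]) h
      · exact hG H.swap (by simp [colorClosure]) h
    have h1 : ex (1 / 2) n (colorClosure H) ≤ ⌊(β + δ) * (n : ℝ) ^ 2⌋₊ := csSup_le' hub
    exact (Nat.cast_le.mpr h1).trans (Nat.floor_le (by positivity))
  have hn1 : 0 < (n : ℝ) * (n - 1) / 2 := by
    have : 0 < (n : ℝ) - 1 := by linarith
    have : 0 < (n : ℝ) := by linarith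
    positivity
  rw [choose_two_cast, div_lt_iff₀ hn1]
  refine hle.trans_lt ?_
  have h1 : (n : ℝ) ≤ (1 + δ) * (n - 1) := by
    have : δ * (1 / δ + 1) ≤ δ * (n - 1) := mul_le_mul_of_nonneg_left (by linarith) hδ.le
    rw [mul_add, mul_one_div_cancel hδ.ne'] at this
    linarith
  have h2 : (n : ℝ) ^ 2 ≤ (1 + δ) * (n * (n - 1)) := by
    have : (n : ℝ) * n ≤ n * ((1 + δ) * (n - 1)) :=
      mul_le_mul_of_nonneg_left h1 (Nat.cast_nonneg n)
    nlinarith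
  have h3 : 2 * ((β + δ) * (1 + δ)) < a := by nlinarith
  calc (β + δ) * (n : ℝ) ^ 2 ≤ (β + δ) * ((1 + δ) * (n * (n - 1))) :=
        mul_le_mul_of_nonneg_left h2 (by linarith)
    _ = 2 * ((β + δ) * (1 + δ)) * (n * (n - 1) / 2) := by ring
    _ < a * (n * (n - 1) / 2) := mul_lt_mul_of_pos_right h3 hn1

end EdgeCounts

/-! ### The extremal constructions. -/

section Construction

/-- The clique on `S` with the edges inside `T` removed. -/
def cliqueDiff {V : Type*} (S T : Finset V) : SimpleGraph V where
  Adj a b := a ≠ b ∧ a ∈ S ∧ b ∈ S ∧ ¬(a ∈ T ∧ b ∈ T)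
  symm := ⟨fun _ _ h => ⟨h.1.symm, h.2.2.1, h.2.1, fun h' => h.2.2.2 h'.symm⟩⟩

theorem ncard_cliqueDiff {V : Type*} [Fintype V] {S T : Finset V} (hTS : T ⊆ S) :
    2 * ((cliqueDiff S T).edgeSet.ncard : ℝ) =
      ((S.card : ℝ) ^ 2 - S.card) - ((T.card : ℝ) ^ 2 - T.card) := by
  classical
  have h1 : ∀ a b, ind ((cliqueDiff S T).Adj a b) =
      (if (a, b) ∈ S.offDiag then (1 : ℝ) else 0) - if (a, b) ∈ T.offDiag then 1 else 0 := by
    intro a b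
    simp only [cliqueDiff, ind, Finset.mem_offDiag]
    by_cases hab : a = b
    · simp [hab]
    · by_cases ha : a ∈ T
      · by_cases hb : b ∈ T
        · simp [hab, ha, hb, hTS ha, hTS hb]
        · simp [hab, ha, hb]
      · simp [hab, ha]
  have h2 : ∀ S : Finset V, ∑ a, ∑ b, (if (a, b) ∈ S.offDiag then (1 : ℝ) else 0) =
      (S.card : ℝ) ^ 2 - S.card := by
    intro S
    rw [← Fintype.sum_prod_type' (f := fun a b => if (a, b) ∈ S.offDiag then (1 : ℝ) else 0),
      Finset.sum_boole, Finset.filter_mem_eq_inter, Finset.univ_inter, Finset.offDiag_card,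
      Nat.cast_sub (Nat.le_mul_self _)]
    push_cast; ring
  rw [← sum_ind_adj]
  simp only [h1, Finset.sum_sub_distrib, h2]

/-- The vertices with index in `[i, j)`. -/
def segment (n i j : ℕ) : Finset (Fin n) := Finset.univ.filter fun a => i ≤ a.val ∧ a.val < j

theorem mem_segment {n i j : ℕ} {a : Fin n} : a ∈ segment n i j ↔ i ≤ a.val ∧ a.val < j := by
  simp [segment]

theorem card_segment {n i j : ℕ} (hj : j ≤ n) : (segment n i j).card = j - i := by
  rw [← Finset.card_map Fin.valEmbedding, ← Nat.card_Ico]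
  congr 1
  ext x
  simp only [Finset.mem_map, mem_segment, Fin.valEmbedding_apply, Finset.mem_Ico]
  exact ⟨fun ⟨a, ha, h⟩ => h ▸ ha, fun h => ⟨⟨x, by omega⟩, h, rfl⟩⟩

/-- Two cliques of orders `m`, one red and one blue, both joined in their color to a common
independent set of order `l`. -/
def cliquePair (n m l : ℕ) : BicoloredGraph (Fin n) where
  red := cliqueDiff (segment n 0 (m + l)) (segment n m (m + l))
  blue := cliqueDiff (segment n m (2 * m + l)) (segment n m (m + l))
  disjoint := by
    rw [SimpleGraph.disjoint_left]
    rintro a b ⟨-, ha, hb, hn⟩ ⟨-, ha', hb', -⟩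
    simp only [mem_segment] at *
    omega

theorem cliquePair_mem_segment {n m l : ℕ} {a b c : Fin n} (hr : (cliquePair n m l).red.Adj a b)
    (hb : (cliquePair n m l).blue.Adj a c) : a ∈ segment n m (m + l) := by
  obtain ⟨-, ha, -, -⟩ := hr
  obtain ⟨-, ha', -, -⟩ := hb
  simp only [mem_segment] at *
  omega

theorem cliquePair_not_adj {n m l : ℕ} {a b : Fin n} (ha : a ∈ segment n m (m + l))
    (hb : b ∈ segment n m (m + l)) : ¬ (cliquePair n m l).underlying.Adj a b := by
  rw [underlying_adj]
  rintro (h | h) <;> exact h.2.2.2 ⟨ha, hb⟩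

theorem cliquePair_edges {n m l : ℕ} (h : 2 * m + l ≤ n) :
    (cliquePair n m l).IsBalanced (1 / 2) ∧
      ((cliquePair n m l).edgeCount : ℝ) = (m : ℝ) ^ 2 + 2 * m * l - m := by
  have hr : 2 * ((cliquePair n m l).red.edgeSet.ncard : ℝ) = (m : ℝ) ^ 2 + 2 * m * l - m := by
    refine (ncard_cliqueDiff fun a ha => ?_).trans ?_
    · simp only [mem_segment] at *; omega
    · rw [card_segment (by omega), card_segment (by omega), Nat.sub_zero, Nat.add_sub_cancel_left]
      push_cast; ring
  have hb : 2 * ((cliquePair n m l).blue.edgeSet.ncard : ℝ) = (m : ℝ) ^ 2 + 2 * m * l - m := by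
    refine (ncard_cliqueDiff fun a ha => ?_).trans ?_
    · simp only [mem_segment] at *; omega
    · rw [card_segment h, card_segment (by omega), Nat.add_sub_cancel_left,
        show 2 * m + l - m = m + l by omega]
      push_cast; ring
  have he : ((cliquePair n m l).edgeCount : ℝ) = (cliquePair n m l).red.edgeSet.ncard +
      (cliquePair n m l).blue.edgeSet.ncard := by exact_mod_cast (cliquePair n m l).edgeCount_eq
  exact ⟨⟨by linarith, by linarith⟩, by linarith⟩

theorem le_ex_of_cliquePair {V : Type*} {F : Set (BicoloredGraph V)} {n m l : ℕ}
    (h : 2 * m + l ≤ n) (hF : ∀ H ∈ F, ¬ (cliquePair n m l).Contains H) :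
    (m : ℝ) ^ 2 + 2 * m * l - m ≤ ex (1 / 2) n F := by
  rw [← (cliquePair_edges h).2]
  exact_mod_cast le_csSup (bddAbove_avoidingEdgeCounts _ _ _)
    ⟨cliquePair n m l, (cliquePair_edges h).1, hF, rfl⟩

/-- Both ends of an isolated edge meet the other color too, so a copy would place that edge inside
the independent middle part. -/
theorem not_contains_of_isolated {V : Type*} {C : BicoloredGraph V} (hC : C.IsCycle)
    (hiso : HasIsolatedEdge C.red ∨ HasIsolatedEdge C.blue) (n m l : ℕ) :
    ¬ (cliquePair n m l).Contains C := by
  rintro ⟨f, hr, hb⟩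
  rcases hiso with ⟨u, v, huv, hu, hv⟩ | ⟨u, v, huv, hu, hv⟩
  · obtain ⟨x, hx⟩ := hC.exists_blue_of_isolated hu
    obtain ⟨y, hy⟩ := hC.exists_blue_of_isolated hv
    exact cliquePair_not_adj (cliquePair_mem_segment (hr _ _ huv) (hb _ _ hx))
      (cliquePair_mem_segment (hr _ _ huv.symm) (hb _ _ hy))
      (underlying_adj.mpr (.inl (hr _ _ huv)))
  · obtain ⟨x, hx⟩ := hC.swap.exists_blue_of_isolated (C := C.swap) hu
    obtain ⟨y, hy⟩ := hC.swap.exists_blue_of_isolated (C := C.swap) hv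
    exact cliquePair_not_adj (cliquePair_mem_segment (hr _ _ hx) (hb _ _ huv))
      (cliquePair_mem_segment (hr _ _ hy) (hb _ _ huv.symm))
      (underlying_adj.mpr (.inr (hb _ _ huv)))

theorem not_contains_of_connected {V : Type*} {C : BicoloredGraph V}
    (hC : C.underlying.Connected) (hn : C.IsNonMonochromatic) (n m : ℕ) :
    ¬ (cliquePair n m 0).Contains C := by
  rintro ⟨f, hr, hb⟩
  obtain ⟨u, x, y, hx, hy⟩ := exists_bichromatic_vertex hC hn.1 hn.2
  have := mem_segment.mp (cliquePair_mem_segment (hr _ _ hx) (hb _ _ hy))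
  omega

/-- The linear error `2 * n` absorbs the rounding of part sizes. -/
theorem eventually_lt_ex {V : Type*} {F : Set (BicoloredGraph V)} {c a : ℝ} (ha : a < c)
    (h : ∀ n : ℕ, 1 ≤ n → c * (n * (n - 1) / 2) - 2 * n ≤ ex (1 / 2) n F) :
    ∀ᶠ n : ℕ in atTop, a < (ex (1 / 2) n F : ℝ) / (n.choose 2 : ℝ) := by
  filter_upwards [eventually_ge_atTop (2 + ⌈4 / (c - a)⌉₊)] with n hn
  have hca : 0 < c - a := sub_pos.mpr ha
  have hpos : 0 < 4 / (c - a) := by positivity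
  have hn' : 4 / (c - a) + 2 ≤ (n : ℝ) := by
    have h1 := Nat.le_ceil (4 / (c - a))
    have h2 : ((2 + ⌈4 / (c - a)⌉₊ : ℕ) : ℝ) ≤ n := by exact_mod_cast hn
    push_cast at h2; linarith
  have hn0 : 0 < (n : ℝ) := by linarith
  have hn1 : 0 < (n : ℝ) * (n - 1) / 2 := by
    have : 0 < (n : ℝ) - 1 := by linarith
    positivity
  rw [choose_two_cast, lt_div_iff₀ hn1]
  refine lt_of_lt_of_le ?_ (h n (by omega))
  have h1 : 4 < (n - 1) * (c - a) := by
    rw [← div_lt_iff₀ hca]; linarith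
  nlinarith [mul_lt_mul_of_pos_left h1 hn0]

end Construction

/-! ### The two cases of the theorem. -/

section CycleTheorem

variable {V : Type*} {C : BicoloredGraph V}

/-- A triangle with both colors has one odd-colored edge; if it is red, `C` maps to the triangle,
otherwise `C.swap` does. -/
theorem IsCycle.hasHom_of_not_triangleMonochromatic (hC : C.IsCycle) (hn : C.IsNonMonochromatic)
    (heven : ∀ (u v : V) (p : C.blue.Walk u v), IsMaximalPath p → Even p.length)
    {K : Type*} {P : BicoloredGraph K} (hP : ¬ P.TriangleMonochromatic) :
    C.HasHom P ∨ C.swap.HasHom P := by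
  unfold TriangleMonochromatic at hP
  push Not at hP
  obtain ⟨a, b, c, hab, hac, hbc⟩ := hP
  rcases underlying_adj.mp hbc with hbc | hbc
  · exact .inr (HasHom.swap (P := P.swap)
      (hC.hasHom_of_triangle hn heven (s := b) (x := a) (y := c) hab.symm hbc hac))
  · exact .inl (hC.hasHom_of_triangle hn heven hac.symm hbc.symm hab)

/-- If all triangles are monochromatic, a triangle at a vertex meeting both colors, with an edge of
the other color there, is the pendant pattern or its swap. -/
theorem IsCycle.hasHom_of_not_mixedTriangleFree (hC : C.IsCycle) (hn : C.IsNonMonochromatic)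
    (heven : ∀ (u v : V) (p : C.blue.Walk u v), IsMaximalPath p → Even p.length)
    (hiso : ¬ HasIsolatedEdge C.red)
    {K : Type*} {P : BicoloredGraph K} (hP : ¬ P.MixedTriangleFree) :
    C.HasHom P ∨ C.swap.HasHom P := by
  by_cases hT : P.TriangleMonochromatic
  swap
  · exact hC.hasHom_of_not_triangleMonochromatic hn heven hT
  unfold MixedTriangleFree at hP
  push Not at hP
  obtain ⟨s, p, q, hp, hq, x, y, hsx, hsy, hxy⟩ := hP
  rcases underlying_adj.mp hsx with hx | hx <;> rcases underlying_adj.mp hsy with hy | hy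
  · rcases underlying_adj.mp hxy with h | h
    · exact .inl (hC.hasHom_of_pendant hn heven hiso hx hy h hq)
    · exact absurd hsy (hT x s y hx.symm h)
  · exact absurd hxy (hT s x y hx hy)
  · exact absurd hxy.symm (hT s y x hy hx)
  · rcases underlying_adj.mp hxy with h | h
    · exact absurd hsy.symm (hT x y s h hx.symm)
    · exact .inr (HasHom.swap (P := P.swap)
        (hC.hasHom_of_pendant hn heven hiso (P := P.swap) hx hy h hp))

theorem IsCycle.hasDensity_of_isolated (hC : C.IsCycle) (hn : C.IsNonMonochromatic)
    (heven : ∀ (u v : V) (p : C.blue.Walk u v), IsMaximalPath p → Even p.length)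
    (hiso : HasIsolatedEdge C.red ∨ HasIsolatedEdge C.blue) :
    HasDensity (1 / 2) (colorClosure C) (2 / 3) := by
  refine tendsto_order.mpr ⟨fun a ha => eventually_lt_ex ha fun n hn1 => ?_, fun a ha => ?_⟩
  -- For `m = l` the edge count is `3 * m ^ 2 - m`, about `n ^ 2 / 3`.
  · refine le_trans ?_ (le_ex_of_cliquePair (m := n / 3) (l := n / 3) (by omega) ?_)
    · have h1 : (n : ℝ) ≤ 3 * (n / 3 : ℕ) + 2 := by exact_mod_cast (by omega : n ≤ 3 * (n / 3) + 2)
      have h2 : 3 * ((n / 3 : ℕ) : ℝ) ≤ n := by exact_mod_cast (by omega : 3 * (n / 3) ≤ n)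
      have h3 : (1 : ℝ) ≤ n := by exact_mod_cast hn1
      have h4 : (0 : ℝ) ≤ (n / 3 : ℕ) := Nat.cast_nonneg _
      nlinarith
    · rintro H (rfl | rfl)
      · exact not_contains_of_isolated hC hiso _ _ _
      · exact not_contains_of_isolated hC.swap hiso.symm _ _ _
  · obtain ⟨k, -, ⟨e⟩⟩ := id hC
    have : Fintype V := Fintype.ofEquiv _ e.toEquiv.symm
    refine eventually_ex_lt C (β := 1 / 3) (by norm_num) (by norm_num) (fun k P hr hb => ?_)
      (by linarith)
    refine hC.hasHom_of_not_triangleMonochromatic hn heven fun hT => ?_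
    rw [density_eq_wedges] at hr hb
    rcases hT.min_wedges_le uniform_mem_stdSimplex with h | h <;> linarith

theorem IsCycle.hasDensity_of_not_isolated (hC : C.IsCycle) (hn : C.IsNonMonochromatic)
    (heven : ∀ (u v : V) (p : C.blue.Walk u v), IsMaximalPath p → Even p.length)
    (hiso : ¬ HasIsolatedEdge C.red) :
    HasDensity (1 / 2) (colorClosure C) (1 / 2) := by
  refine tendsto_order.mpr ⟨fun a ha => eventually_lt_ex ha fun n hn1 => ?_, fun a ha => ?_⟩
  -- Two disjoint cliques, one of each color: `m ^ 2 - m` edges, about `n ^ 2 / 4`.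
  · refine le_trans ?_ (le_ex_of_cliquePair (m := n / 2) (l := 0) (by omega) ?_)
    · have h1 : (n : ℝ) ≤ 2 * (n / 2 : ℕ) + 1 := by exact_mod_cast (by omega : n ≤ 2 * (n / 2) + 1)
      have h2 : 2 * ((n / 2 : ℕ) : ℝ) ≤ n := by exact_mod_cast (by omega : 2 * (n / 2) ≤ n)
      have h3 : (1 : ℝ) ≤ n := by exact_mod_cast hn1
      have h4 : (0 : ℝ) ≤ (n / 2 : ℕ) := Nat.cast_nonneg _
      push_cast
      nlinarith
    · rintro H (rfl | rfl)
      · exact not_contains_of_connected hC.connected hn _ _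
      · exact not_contains_of_connected hC.swap.connected hn.symm _ _
  · obtain ⟨k, -, ⟨e⟩⟩ := id hC
    have : Fintype V := Fintype.ofEquiv _ e.toEquiv.symm
    refine eventually_ex_lt C (β := 1 / 4) (by norm_num) (by norm_num) (fun k P hr hb => ?_)
      (by linarith)
    refine hC.hasHom_of_not_mixedTriangleFree hn heven hiso fun hT => ?_
    rw [density_eq_wedges] at hr hb
    rcases hT.min_wedges_le uniform_mem_stdSimplex with h | h <;> linarith

end CycleTheorem

end BicoloredGraph

theorem theorem4p1 {V : Type*} (C : BicoloredGraph V)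
    (hcycle : C.IsCycle) (hnonmono : C.IsNonMonochromatic) (hinev : C.IsInevitable)
    (heven : ∀ (u v : V) (p : C.blue.Walk u v),
      BicoloredGraph.IsMaximalPath p → Even p.length) :
    ((BicoloredGraph.HasIsolatedEdge C.red ∨ BicoloredGraph.HasIsolatedEdge C.blue) →
      BicoloredGraph.HasDensity (1 / 2) (BicoloredGraph.colorClosure C) (2 / 3)) ∧
    (¬ (BicoloredGraph.HasIsolatedEdge C.red ∨ BicoloredGraph.HasIsolatedEdge C.blue) →
      (∀ (u v : V) (p : C.red.Walk u v), BicoloredGraph.IsMaximalPath p → 2 ≤ p.length) ∧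
      (∀ (u v : V) (p : C.blue.Walk u v), BicoloredGraph.IsMaximalPath p → 2 ≤ p.length) ∧
      BicoloredGraph.HasDensity (1 / 2) (BicoloredGraph.colorClosure C) (1 / 2)) := by
  refine ⟨fun h => hcycle.hasDensity_of_isolated hnonmono heven h, fun h => ?_⟩
  obtain ⟨hr, hb⟩ := not_or.mp h
  exact ⟨fun _ _ p hp => BicoloredGraph.two_le_length_of_isMaximalPath hr p hp,
    fun _ _ p hp => BicoloredGraph.two_le_length_of_isMaximalPath hb p hp,
    hcycle.hasDensity_of_not_isolated hnonmono heven hr⟩
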